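/- Let $k\ge 1$ be an integer, let $s\ge 0$ satisfy $s>\frac{4k-5}{4(2k-1)}$, and let $b>\frac12$. Put $\langle a\rangle=1+|a|$ and $\gamma(\xi)=\sqrt{\xi^2+\xi^4}$, let $$\widetilde u(\tau,\xi)=\int_{\mathbb R}\int_{\mathbb R}e^{-i(x\xi+t\tau)}u(t,x)\,dt\,dx$$ denote the space-time Fourier transform (extended to $L^2(\mathbb R\times\mathbb R)$ by Plancherel), and for $\sigma,\beta\ge0$ let $X_{\sigma,\beta}$ be the space of all complex-valued $u\in L^2(\mathbb R\times\mathbb R)$ with $$\|u\|_{X_{\sigma,\beta}}=\big\|\langle|\tau|-\gamma(\xi)\rangle^{\beta}\langle\xi\rangle^{\sigma}\,\widetilde u(\tau,\xi)\big\|_{L^2_{\xi,\tau}}<\infty .$$ Then there is a constant $C=C(k,s,b)$ such that for every $u\in X_{s,b}$ the function $|u|^{2k}u$ belongs to $L^2(\mathbb R\times\mathbb R)$ and to $X_{s,0}$, and $$\big\||u|^{2k}u\big\|_{X_{s,0}}\le C\,\|u\|_{X_{s,b}}^{2k+1}.$$ -/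

import Mathlib

open MeasureTheory
open scoped ENNReal NNReal FourierTransform

/-- Space-time `ℝ_t × ℝ_x`, and also its dual `ℝ_τ × ℝ_ξ`: coordinate `0` is the time `t`
(respectively `τ`), coordinate `1` is the space variable `x` (respectively `ξ`). -/
abbrev SpaceTime : Type := EuclideanSpace ℝ (Fin 2)

/-- Square integrable complex-valued functions of space-time. -/
abbrev L2ST : Type := Lp ℂ 2 (volume : Measure SpaceTime)

noncomputable section

/-- The bracket `⟨a⟩ = 1 + |a|`. -/
def bracket (a : ℝ) : ℝ := 1 + |a|

/-- The dispersion relation `γ(ξ) = √(ξ² + ξ⁴)` of the Boussinesq equation. -/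
def gammaBq (ξ : ℝ) : ℝ := Real.sqrt (ξ ^ 2 + ξ ^ 4)

/-- The space-time Fourier transform
`ũ(τ, ξ) = ∫∫ exp (-i (x ξ + t τ)) u(t, x) dt dx` (extended to `L²` by Plancherel).
Mathlib's `𝓕` uses the kernel `exp (-2 π i ⟨v, w⟩)`, hence the rescaling of the frequency. -/
def stFourier (u : L2ST) (p : SpaceTime) : ℂ :=
  ((𝓕 u : L2ST) : SpaceTime → ℂ) ((2 * Real.pi)⁻¹ • p)

/-- The Bourgain weight `⟨|τ| - γ(ξ)⟩ ^ b * ⟨ξ⟩ ^ s`. -/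
def bqWeight (s b : ℝ) (p : SpaceTime) : ℝ :=
  bracket (|p 0| - gammaBq (p 1)) ^ b * bracket (p 1) ^ s

/-- The norm of `X_{s,b}(ℝ × ℝ)`, namely the `L²_{ξ,τ}` norm of
`⟨|τ| - γ(ξ)⟩ ^ b * ⟨ξ⟩ ^ s * ũ(τ, ξ)`, with the value `∞` allowed. -/
def xNorm (s b : ℝ) (u : L2ST) : ℝ≥0∞ :=
  eLpNorm (fun p : SpaceTime => bqWeight s b p • stFourier u p) 2 volume

/-- Membership in `X_{s,b}(ℝ × ℝ)`. If `s` and `b` are nonnegative the weight is at least `1`,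
so that all elements of `X_{s,b}` are square integrable functions; this is the range in which
the definition is meant to be used. -/
def MemX (s b : ℝ) (u : L2ST) : Prop := xNorm s b u < ∞

/-- The nonlinearity `|u|^{2k} u`. -/
def powerNonlinearity (k : ℕ) (u : SpaceTime → ℂ) (p : SpaceTime) : ℂ :=
  ((‖u p‖ ^ (2 * k) : ℝ) : ℂ) * u p

end

open Filter Topology
open scoped Convolution

/-! The estimate is Hölder's inequality fed by Strichartz bounds, and modulation weights enter only
through `b > 1/2`. Since `ξ² ≤ γ(ξ) ≤ ξ² + 1/2`, the weight on `τ ≥ 0` is comparable to the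
Schrödinger weight `⟨τ - ξ²⟩ ^ b`; reflection in frequency handles `τ < 0`.

`L⁶` bound: cubing `𝓕⁻ g` turns its `L⁶` norm into the `L²` norm of a triple convolution. By
weighted Cauchy–Schwarz it suffices that the triple self-convolution of the integrable profile `ψ(τ
- cξ²)` is bounded. This reduces to integrating `ψ(A - c|y|²)` over the plane, where polar
coordinates give a bound independent of `A` (`lconvolution_paraboloid_le`,
`eLpNorm_six_fourierInv_le`).

`L^{6k}` bound: on `|ξ| ≲ R` Cauchy–Schwarz gives an `L^∞` bound with loss `R^{1/2}`. Interpolation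
with `L⁶` loses `R^{1/2 - 1/(2k)}`, and the dyadic sum converges when `s` exceeds that exponent
(`eLpNorm_fourierInv_le`). The hypothesis on `s` implies this for `k ≥ 2`; for `k = 1` the `L⁶`
bound suffices.

Nonlinear bound: the norms see only `|ũ|`, so `ũ` may be replaced by a nonnegative symmetric
majorant. The weight `⟨ξ⟩ ^ s` is subadditive up to a constant and falls on one factor of the
convolution; that factor goes in `L⁶`, the other `2k` in `L^{6k}` (`freqNorm_convNonlinearity_le`).
This is done for bounded, compactly supported `ũ`. The general case follows by truncation: the
nonlinear bound itself yields a linear `L^{4k+2}` bound, which makes the nonlinearity converge in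
`L²`. -/

/-! ### Brackets and integration over space-time -/

theorem one_le_bracket (a : ℝ) : 1 ≤ bracket a := by
  unfold bracket; linarith [abs_nonneg a]

theorem bracket_pos (a : ℝ) : 0 < bracket a := zero_lt_one.trans_le (one_le_bracket a)

@[fun_prop]
theorem continuous_bracket : Continuous bracket := by
  unfold bracket; fun_prop

/-- `⟨t⟩ ^ (-r)` as an extended nonnegative function. -/
noncomputable def bracketDecay (r t : ℝ) : ℝ≥0∞ := ENNReal.ofReal (bracket t ^ (-r))

@[fun_prop]
theorem measurable_bracketDecay (r : ℝ) : Measurable (bracketDecay r) := by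
  unfold bracketDecay
  exact ENNReal.measurable_ofReal.comp (continuous_bracket.measurable.pow_const _)

theorem lintegral_bracketDecay_lt_top {r : ℝ} (hr : 1 < r) : ∫⁻ t, bracketDecay r t < ∞ := by
  have := finite_integral_one_add_norm (E := ℝ) (μ := volume) (r := r) (by simpa using hr)
  simpa [bracketDecay, bracket] using this

theorem lintegral_spaceTime {f : SpaceTime → ℝ≥0∞} (hf : Measurable f) :
    ∫⁻ q, f q = ∫⁻ ξ : ℝ, ∫⁻ τ : ℝ, f !₂[τ, ξ] := by
  have h1 := (volume_preserving_finTwoArrow ℝ).symm.trans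
    (EuclideanSpace.volume_preserving_symm_measurableEquiv_toLp (Fin 2)).symm
  rw [← h1.lintegral_comp hf, Measure.volume_eq_prod,
    lintegral_prod_symm _ (by fun_prop)]
  rfl

theorem lintegral_comp_mul_left_real {f : ℝ → ℝ≥0∞} (hf : Measurable f) {a : ℝ} (ha : a ≠ 0) :
    ∫⁻ x, f (a * x) = ENNReal.ofReal |a⁻¹| * ∫⁻ x, f x := by
  rw [← lintegral_map hf (measurable_const_mul a), Real.map_volume_mul_left ha,
    lintegral_smul_measure, smul_eq_mul]

/-! ### Triple convolution of a thickened paraboloid -/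

/-- In two dimensions the area element is `r dr dθ = ½ d(r²) dθ`, so the push-forward of Lebesgue
measure under `|·|²` has constant density. This is why the bound does not depend on `A`. -/
theorem lintegral_mul_comp_sub_sq_le {ψ : ℝ → ℝ≥0∞} (hψ : Measurable ψ) {c : ℝ} (hc : 0 < c)
    (A : ℝ) :
    ∫⁻ p : ℝ × ℝ, ψ (A - c * (p.1 ^ 2 + p.2 ^ 2)) ≤
      ENNReal.ofReal (Real.pi / c) * ∫⁻ t, ψ t := by
  rw [← lintegral_comp_polarCoord_symm]
  have h1 : ∀ p : ℝ × ℝ, ψ (A - c * ((polarCoord.symm p).1 ^ 2 + (polarCoord.symm p).2 ^ 2))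
      = ψ (A - c * p.1 ^ 2) := by
    intro p
    congr 2
    simp only [polarCoord_symm_apply]
    linear_combination c * p.1 ^ 2 * Real.cos_sq_add_sin_sq p.2
  simp only [h1, smul_eq_mul, polarCoord_target]
  rw [Measure.volume_eq_prod, ← Measure.prod_restrict, lintegral_prod _ (by fun_prop)]
  simp only [lintegral_const, Measure.restrict_apply MeasurableSet.univ, Set.univ_inter,
    Real.volume_Ioo]
  rw [lintegral_mul_const _ (by fun_prop)]
  -- Substitution `x = A - c r²`: its Jacobian `2 c r` absorbs the polar factor `r`.
  have h2 := lintegral_image_eq_lintegral_abs_deriv_mul (s := Set.Ioi (0 : ℝ))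
    (f := fun r => A - c * r ^ 2) (f' := fun r => - (2 * c * r)) measurableSet_Ioi
    (fun x _ => by
      have := ((hasDerivAt_pow 2 x).const_mul c).const_sub A
      refine HasDerivAt.hasDerivWithinAt (this.congr_deriv ?_)
      simp; ring)
    (fun x hx y hy h => by
      have hx' : (0:ℝ) < x := hx
      have hy' : (0:ℝ) < y := hy
      have : x ^ 2 = y ^ 2 := by
        have h' : c * x ^ 2 = c * y ^ 2 := by simpa using h
        exact mul_left_cancel₀ hc.ne' h'
      exact (pow_left_inj₀ hx'.le hy'.le two_ne_zero).1 this) ψ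
  have h3 : ∫⁻ r in Set.Ioi (0:ℝ), ENNReal.ofReal r * ψ (A - c * r ^ 2)
      = ENNReal.ofReal (1 / (2 * c)) *
        ∫⁻ x in Set.Ioi (0:ℝ), ENNReal.ofReal |-(2 * c * x)| * ψ (A - c * x ^ 2) := by
    rw [← lintegral_const_mul _ (by fun_prop)]
    refine setLIntegral_congr_fun measurableSet_Ioi fun r hr => ?_
    have hr' : (0:ℝ) < r := hr
    rw [← mul_assoc, ← ENNReal.ofReal_mul (by positivity), abs_neg, abs_of_pos (by positivity)]
    congr 2
    field_simp
  rw [h3, ← h2, mul_right_comm, ← ENNReal.ofReal_mul (by positivity)]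
  refine mul_le_mul' (ENNReal.ofReal_le_ofReal (le_of_eq ?_)) (setLIntegral_le_lintegral _ _)
  field_simp; ring

/-- Three squares with prescribed sum `ξ` form `ξ²/3` plus a positive definite quadratic form in the
deviations from `ξ/3`. Diagonalising it and rescaling one axis by `√3/2` reduces to the radial case.
-/
theorem lintegral_comp_quadratic_le {ψ : ℝ → ℝ≥0∞} (hψ : Measurable ψ) {c : ℝ} (hc : 0 < c)
    (A ξ : ℝ) :
    ∫⁻ y : ℝ, ∫⁻ z : ℝ, ψ (A - c * (y ^ 2 + z ^ 2 + (ξ - y - z) ^ 2)) ≤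
      ENNReal.ofReal (2 / √3) * (ENNReal.ofReal (Real.pi / (2 * c)) * ∫⁻ t, ψ t) := by
  set B := A - c * ξ ^ 2 / 3
  have h3 : (0:ℝ) < √3 := by positivity
  have h3' : √3 ^ 2 = 3 := Real.sq_sqrt (by norm_num)
  calc _ = ∫⁻ y : ℝ, ∫⁻ z : ℝ, ψ (B - (2 * c) * (z ^ 2 + (√3 / 2 * (y - ξ / 3)) ^ 2)) := by
        refine lintegral_congr fun y => ?_
        rw [← lintegral_add_right_eq_self _ (ξ / 3 - (y - ξ / 3) / 2)]
        refine lintegral_congr fun z => congrArg ψ ?_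
        simp only [B]
        linear_combination (c * (y - ξ / 3) ^ 2 / 2) * h3'
    _ = ∫⁻ y : ℝ, ∫⁻ z : ℝ, ψ (B - (2 * c) * (z ^ 2 + (√3 / 2 * y) ^ 2)) :=
        lintegral_sub_right_eq_self
          (fun y => ∫⁻ z : ℝ, ψ (B - (2 * c) * (z ^ 2 + (√3 / 2 * y) ^ 2))) (ξ / 3)
    _ = ENNReal.ofReal (2 / √3) *
          ∫⁻ y : ℝ, ∫⁻ z : ℝ, ψ (B - (2 * c) * (z ^ 2 + y ^ 2)) := by
        rw [lintegral_comp_mul_left_real (a := √3 / 2)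
          (f := fun y => ∫⁻ z : ℝ, ψ (B - (2 * c) * (z ^ 2 + y ^ 2)))
          (Measurable.lintegral_prod_right' (f := fun p : ℝ × ℝ =>
            ψ (B - (2 * c) * (p.2 ^ 2 + p.1 ^ 2))) (by fun_prop)) (by positivity),
          inv_div, abs_of_pos (by positivity)]
    _ ≤ _ := by
        gcongr
        refine le_trans (le_of_eq ?_) (lintegral_mul_comp_sub_sq_le hψ (c := 2 * c) (by positivity) B)
        rw [lintegral_lintegral_swap (by fun_prop), Measure.volume_eq_prod,
          lintegral_prod _ (by fun_prop)]

/-- Shifting each time variable by the paraboloid leaves `ψ(t) ψ(s)` times a third profile, whose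
dependence on the space variables is the quadratic form above. Those variables are integrated out
first, uniformly in `t`, `s` and `p`. -/
theorem lconvolution_paraboloid_le {ψ : ℝ → ℝ≥0∞} (hψ : Measurable ψ) {c : ℝ} (hc : 0 < c)
    (p : SpaceTime) :
    ((fun q : SpaceTime => ψ (q 0 - c * q 1 ^ 2)) ⋆ₗ
      ((fun q : SpaceTime => ψ (q 0 - c * q 1 ^ 2)) ⋆ₗ
        (fun q : SpaceTime => ψ (q 0 - c * q 1 ^ 2)))) p ≤
      ENNReal.ofReal (2 / √3) * ENNReal.ofReal (Real.pi / (2 * c)) * (∫⁻ t, ψ t) ^ 3 := by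
  set H : SpaceTime → ℝ≥0∞ := fun q => ψ (q 0 - c * q 1 ^ 2) with hH
  have hHm : Measurable H := by fun_prop
  have hHHm : Measurable (H ⋆ₗ H) := measurable_lconvolution _ hHm hHm
  have hin : ∀ x : SpaceTime, (H ⋆ₗ H) x =
      ∫⁻ z : ℝ, ∫⁻ s : ℝ, ψ s * ψ (x 0 - s - c * (z ^ 2 + (x 1 - z) ^ 2)) := by
    intro x
    rw [lconvolution_def, lintegral_spaceTime (by fun_prop)]
    refine lintegral_congr fun z => ?_
    rw [← lintegral_add_right_eq_self _ (c * z ^ 2)]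
    refine lintegral_congr fun s => ?_
    simp [hH]
    congr 2
    · ring
  calc (H ⋆ₗ (H ⋆ₗ H)) p
      = ∫⁻ y : ℝ, ∫⁻ t : ℝ, ψ t * ∫⁻ z : ℝ, ∫⁻ s : ℝ,
          ψ s * ψ (p 0 - t - s - c * (y ^ 2 + z ^ 2 + (p 1 - y - z) ^ 2)) := by
        rw [lconvolution_def, lintegral_spaceTime (by fun_prop)]
        refine lintegral_congr fun y => ?_
        rw [← lintegral_add_right_eq_self _ (c * y ^ 2)]
        refine lintegral_congr fun t => ?_
        rw [hin]
        simp [hH]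
        congr 1
        refine lintegral_congr fun z => lintegral_congr fun s => ?_
        congr 2
        ring
    _ = ∫⁻ t : ℝ, ψ t * ∫⁻ s : ℝ, ψ s * ∫⁻ y : ℝ, ∫⁻ z : ℝ,
          ψ (p 0 - t - s - c * (y ^ 2 + z ^ 2 + (p 1 - y - z) ^ 2)) := by
        rw [lintegral_lintegral_swap (by fun_prop)]
        refine lintegral_congr fun t => ?_
        rw [lintegral_const_mul _ (by fun_prop)]
        congr 1
        have : ∀ y : ℝ, ∫⁻ z : ℝ, ∫⁻ s : ℝ,
            ψ s * ψ (p 0 - t - s - c * (y ^ 2 + z ^ 2 + (p 1 - y - z) ^ 2)) =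
            ∫⁻ s : ℝ, ψ s * ∫⁻ z : ℝ,
              ψ (p 0 - t - s - c * (y ^ 2 + z ^ 2 + (p 1 - y - z) ^ 2)) := by
          intro y
          rw [lintegral_lintegral_swap (by fun_prop)]
          refine lintegral_congr fun s => ?_
          rw [lintegral_const_mul _ (by fun_prop)]
        simp_rw [this]
        rw [lintegral_lintegral_swap (by fun_prop)]
        refine lintegral_congr fun s => ?_
        rw [lintegral_const_mul _ (by fun_prop)]
    _ ≤ ∫⁻ t : ℝ, ψ t * ∫⁻ s : ℝ, ψ s *
          (ENNReal.ofReal (2 / √3) * (ENNReal.ofReal (Real.pi / (2 * c)) * ∫⁻ t, ψ t)) := by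
        gcongr with t s
        exact lintegral_comp_quadratic_le hψ hc _ _
    _ = _ := by
        simp_rw [lintegral_mul_const _ hψ]
        ring

/-! ### Cauchy–Schwarz for convolutions -/

theorem sq_lconvolution_le {f₁ f₂ H₁ H₂ N₁ N₂ : SpaceTime → ℝ≥0∞}
    (hH₁ : AEMeasurable H₁) (hH₂ : AEMeasurable H₂) (hN₁ : AEMeasurable N₁) (hN₂ : AEMeasurable N₂)
    (h₁ : ∀ q, f₁ q ^ 2 ≤ H₁ q * N₁ q) (h₂ : ∀ q, f₂ q ^ 2 ≤ H₂ q * N₂ q) (p : SpaceTime) :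
    (f₁ ⋆ₗ f₂) p ^ 2 ≤ (H₁ ⋆ₗ H₂) p * (N₁ ⋆ₗ N₂) p := by
  simp only [lconvolution_def]
  have key : ∀ {a b x y c d : ℝ≥0∞}, a ^ 2 ≤ b * x → c ^ 2 ≤ d * y →
      a * c ≤ (b * d) ^ (1 / 2 : ℝ) * (x * y) ^ (1 / 2 : ℝ) := by
    intro a b x y c d h h'
    rw [← ENNReal.mul_rpow_of_nonneg _ _ (by norm_num), one_div, ENNReal.le_rpow_inv_iff (by norm_num)]
    calc (a * c) ^ (2 : ℝ) = a ^ 2 * c ^ 2 := by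
          rw [ENNReal.rpow_two, mul_pow]
      _ ≤ (b * x) * (d * y) := mul_le_mul' h h'
      _ = _ := by ring
  have hs : Measure.QuasiMeasurePreserving (fun y : SpaceTime => -y + p) :=
    (measurePreserving_add_right volume p).quasiMeasurePreserving.comp
      (Measure.measurePreserving_neg volume).quasiMeasurePreserving
  calc _ ≤ ((∫⁻ y, H₁ y * H₂ (-y + p)) ^ (1 / 2 : ℝ) * (∫⁻ y, N₁ y * N₂ (-y + p)) ^ (1 / 2 : ℝ)) ^ 2 := by
        gcongr
        refine le_trans (lintegral_mono fun y => key (h₁ y) (h₂ (-y + p))) ?_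
        exact ENNReal.lintegral_mul_norm_pow_le
          (hH₁.mul (hH₂.comp_quasiMeasurePreserving hs))
          (hN₁.mul (hN₂.comp_quasiMeasurePreserving hs)) (by norm_num) (by norm_num) (by norm_num)
    _ = _ := by
        rw [mul_pow, ← ENNReal.rpow_two, ← ENNReal.rpow_two, ← ENNReal.rpow_mul,
          ← ENNReal.rpow_mul]
        norm_num

theorem lintegral_lconvolution {f g : SpaceTime → ℝ≥0∞} (hf : AEMeasurable f)
    (hg : AEMeasurable g) : ∫⁻ p, (f ⋆ₗ g) p = (∫⁻ p, f p) * ∫⁻ p, g p := by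
  simp only [lconvolution_def]
  rw [lintegral_lintegral_swap]
  · calc _ = ∫⁻ y, f y * ∫⁻ x, g x := by
          refine lintegral_congr fun y => ?_
          have hs : Measure.QuasiMeasurePreserving (fun x : SpaceTime => -y + x) :=
            (measurePreserving_add_left volume (-y)).quasiMeasurePreserving
          rw [lintegral_const_mul'' _ (f := fun x => g (-y + x)) (hg.comp_quasiMeasurePreserving hs),
            lintegral_add_left_eq_self]
      _ = _ := lintegral_mul_const'' _ hf
  · simpa using! by fun_prop

/-! ### Integrable bounded functions and their inverse Fourier transforms -/

/-- Integrable functions that are bounded everywhere. -/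
structure IntegrableBounded {𝕜 : Type*} [RCLike 𝕜] (g : SpaceTime → 𝕜) : Prop where
  integrable : Integrable g
  bounded : ∃ C : ℝ, ∀ x, ‖g x‖ ≤ C

namespace IntegrableBounded

variable {𝕜 : Type*} [RCLike 𝕜] {f g : SpaceTime → 𝕜}

theorem memLp_two (hg : IntegrableBounded g) : MemLp g 2 := by
  obtain ⟨C, hC⟩ := hg.bounded
  refine (memLp_two_iff_integrable_sq_norm hg.integrable.1).2 ?_
  refine (hg.integrable.norm.const_mul C).mono' (hg.integrable.1.norm.pow 2) (.of_forall fun x => ?_)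
  rw [Real.norm_eq_abs, abs_of_nonneg (by positivity), sq]
  exact mul_le_mul_of_nonneg_right (hC x) (norm_nonneg _)

theorem add (hf : IntegrableBounded f) (hg : IntegrableBounded g) :
    IntegrableBounded (fun x => f x + g x) := by
  obtain ⟨C, hC⟩ := hf.bounded
  obtain ⟨D, hD⟩ := hg.bounded
  exact ⟨hf.integrable.add hg.integrable, C + D, fun x =>
    (norm_add_le _ _).trans (add_le_add (hC x) (hD x))⟩

theorem mono (hf : IntegrableBounded f) (hg : AEStronglyMeasurable g)
    (h : ∀ x, ‖g x‖ ≤ ‖f x‖) : IntegrableBounded g := by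
  obtain ⟨C, hC⟩ := hf.bounded
  exact ⟨hf.integrable.mono hg (.of_forall h), C, fun x => (h x).trans (hC x)⟩

theorem comp_neg (hf : IntegrableBounded f) : IntegrableBounded (fun x => f (-x)) := by
  obtain ⟨C, hC⟩ := hf.bounded
  exact ⟨hf.integrable.comp_neg, C, fun x => hC _⟩

theorem sub (hf : IntegrableBounded f) (hg : IntegrableBounded g) :
    IntegrableBounded (fun x => f x - g x) := by
  obtain ⟨C, hC⟩ := hf.bounded
  obtain ⟨D, hD⟩ := hg.bounded
  exact ⟨hf.integrable.sub hg.integrable, C + D, fun x =>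
    (norm_sub_le _ _).trans (add_le_add (hC x) (hD x))⟩

theorem convolutionExists (hf : IntegrableBounded f) (hg : IntegrableBounded g) :
    ConvolutionExists f g (ContinuousLinearMap.mul 𝕜 𝕜) := by
  intro x
  obtain ⟨C, hC⟩ := hg.bounded
  have h1 : AEStronglyMeasurable (fun t => g (x - t)) :=
    hg.integrable.1.comp_quasiMeasurePreserving (quasiMeasurePreserving_sub_left volume x)
  exact hf.integrable.mul_bdd h1 (.of_forall fun t => hC (x - t))

theorem conv (hf : IntegrableBounded f) (hg : IntegrableBounded g) :
    IntegrableBounded (f ⋆[ContinuousLinearMap.mul 𝕜 𝕜] g) := by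
  refine ⟨hf.integrable.integrable_convolution _ hg.integrable, ?_⟩
  obtain ⟨C, hC⟩ := hg.bounded
  refine ⟨∫ t, ‖f t‖ * C, fun x => ?_⟩
  refine norm_integral_le_of_norm_le (hf.integrable.norm.mul_const C) (.of_forall fun t => ?_)
  simp only [ContinuousLinearMap.mul_apply', norm_mul]
  exact mul_le_mul_of_nonneg_left (hC _) (norm_nonneg _)

theorem const_mul (hf : IntegrableBounded f) (c : 𝕜) : IntegrableBounded (fun x => c * f x) := by
  obtain ⟨C, hC⟩ := hf.bounded
  exact ⟨hf.integrable.const_mul c, ‖c‖ * C, fun x => by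
    rw [norm_mul]; exact mul_le_mul_of_nonneg_left (hC x) (norm_nonneg _)⟩

theorem norm (hf : IntegrableBounded f) : IntegrableBounded (fun x => ‖f x‖) := by
  obtain ⟨C, hC⟩ := hf.bounded
  exact ⟨hf.integrable.norm, C, fun x => by simpa using hC x⟩

theorem ofReal {f : SpaceTime → ℝ} (hf : IntegrableBounded f) :
    IntegrableBounded (fun x => (f x : ℂ)) := by
  obtain ⟨C, hC⟩ := hf.bounded
  exact ⟨hf.integrable.ofReal, C, fun x => by simpa using hC x⟩

theorem star_comp_neg (hf : IntegrableBounded f) :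
    IntegrableBounded (fun x => starRingEnd 𝕜 (f (-x))) := by
  obtain ⟨C, hC⟩ := hf.bounded
  have h := hf.comp_neg.integrable
  exact ⟨h.congr' (RCLike.continuous_conj.comp_aestronglyMeasurable h.1)
    (.of_forall fun x => by simp), C, fun x => by simpa using hC _⟩

end IntegrableBounded

theorem fourierInv_conv {f g : SpaceTime → ℂ} (hf : Integrable f) (hg : Integrable g)
    (x : SpaceTime) :
    𝓕⁻ (f ⋆[ContinuousLinearMap.mul ℂ ℂ] g) x = 𝓕⁻ f x * 𝓕⁻ g x := by
  simp only [Real.fourierInv_eq_fourier_neg]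
  exact Real.fourier_mul_convolution_eq hf hg (-x)

theorem enorm_conv_le (f g : SpaceTime → ℂ) (x : SpaceTime) :
    ‖(f ⋆[ContinuousLinearMap.mul ℂ ℂ] g) x‖ₑ ≤ ((fun q => ‖f q‖ₑ) ⋆ₗ (fun q => ‖g q‖ₑ)) x := by
  refine (enorm_integral_le_lintegral_enorm _).trans (le_of_eq ?_)
  simp only [lconvolution_def, ContinuousLinearMap.mul_apply', enorm_mul]
  refine lintegral_congr fun y => ?_
  rw [neg_add_eq_sub]

theorem continuous_fourierInv {g : SpaceTime → ℂ} (hg : Integrable g) : Continuous (𝓕⁻ g) := by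
  have : (𝓕⁻ g : SpaceTime → ℂ) = fun x => 𝓕 g (-x) := by
    ext x; exact Real.fourierInv_eq_fourier_neg g x
  rw [this]
  exact (VectorFourier.fourierIntegral_continuous Real.continuous_fourierChar
    (by exact continuous_inner) hg).comp continuous_neg

theorem fourierInv_add_of_integrable {f g : SpaceTime → ℂ} (hf : Integrable f)
    (hg : Integrable g) : (𝓕⁻ (fun q => f q + g q) : SpaceTime → ℂ) = 𝓕⁻ f + 𝓕⁻ g := by
  ext x
  simp only [Pi.add_apply, Real.fourierInv_eq, smul_add]
  have hi : ∀ f : SpaceTime → ℂ, Integrable f →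
      Integrable (fun v => Real.fourierChar (inner ℝ v x) • f v) := by
    intro f hf
    simpa using (Real.fourierIntegral_convergent_iff (-x)).2 hf
  exact integral_add (hi _ hf) (hi _ hg)

theorem enorm_fourierInv_le (g : SpaceTime → ℂ) (x : SpaceTime) :
    ‖𝓕⁻ g x‖ₑ ≤ ∫⁻ q, ‖g q‖ₑ := by
  rw [Real.fourierInv_eq]
  refine (enorm_integral_le_lintegral_enorm _).trans (le_of_eq ?_)
  refine lintegral_congr fun y => ?_
  rw [Circle.smul_def, enorm_smul, ← ofReal_norm, Circle.norm_coe, ENNReal.ofReal_one, one_mul]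

/-- Both sides are locally integrable and agree against test functions: the transform is moved onto
the test function, as tempered distributions on the left and by Fubini on the right. -/
theorem coeFn_fourierInv_toLp {g : SpaceTime → ℂ} (hg : Integrable g) (hg2 : MemLp g 2) :
    ((𝓕⁻ (hg2.toLp g) : L2ST) : SpaceTime → ℂ) =ᵐ[volume] 𝓕⁻ g := by
  refine ae_eq_of_integral_contDiff_smul_eq ?_ (continuous_fourierInv hg).locallyIntegrable ?_
  · exact (Lp.memLp _).locallyIntegrable (by norm_num)
  intro φ hφ hφs
  have hs : HasCompactSupport (fun x => (φ x : ℂ)) :=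
    hφs.comp_left (g := fun r : ℝ => (r : ℂ)) (by simp)
  have hc : ContDiff ℝ (⊤ : ℕ∞) (fun x => (φ x : ℂ)) := Complex.ofRealCLM.contDiff.comp hφ
  set Φ : SchwartzMap SpaceTime ℂ := hs.toSchwartzMap hc with hΦ
  have e := congrArg (fun T => T Φ) (Lp.fourierInv_toTemperedDistribution_eq (hg2.toLp g))
  simp only [Lp.toTemperedDistribution_apply, TemperedDistribution.fourierInv_apply] at e
  have e1 : ∫ x, φ x • ((𝓕⁻ (hg2.toLp g) : L2ST) : SpaceTime → ℂ) x
      = ∫ x, Φ x • ((𝓕⁻ (hg2.toLp g) : L2ST) : SpaceTime → ℂ) x := by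
    simp [hΦ]
  have e2 : ∫ x, φ x • 𝓕⁻ g x = ∫ x, Φ x • 𝓕⁻ g x := by
    simp [hΦ]
  rw [e1, e2, ← e]
  have e3 : ∫ x, (𝓕⁻ Φ) x • (hg2.toLp g) x = ∫ x, (𝓕⁻ Φ) x • g x := by
    refine integral_congr_ae ?_
    filter_upwards [hg2.coeFn_toLp] with x hx
    rw [hx]
  rw [e3, SchwartzMap.fourierInv_coe]
  have h := VectorFourier.integral_fourierIntegral_smul_eq_flip (μ := volume) (ν := volume)
    (L := -innerₗ SpaceTime) Real.continuous_fourierChar (by exact continuous_inner.neg) Φ.integrable hg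
  have hflip : VectorFourier.fourierIntegral Real.fourierChar volume
      (-innerₗ SpaceTime).flip g = 𝓕⁻ g := by
    ext x
    rw [Real.fourierInv_eq, VectorFourier.fourierIntegral]
    simp [real_inner_comm]
  rw [hflip] at h
  exact h

theorem eLpNorm_fourierInv {g : SpaceTime → ℂ} (hg : Integrable g) (hg2 : MemLp g 2) :
    eLpNorm (𝓕⁻ g) 2 = eLpNorm g 2 := by
  rw [← eLpNorm_congr_ae (coeFn_fourierInv_toLp hg hg2), ← eLpNorm_congr_ae hg2.coeFn_toLp,
    ← Lp.enorm_def, ← Lp.enorm_def]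
  have h := Lp.norm_fourier_eq (𝓕⁻ (hg2.toLp g) : L2ST)
  rw [FourierTransform.fourier_fourierInv_eq] at h
  rw [← ofReal_norm, ← ofReal_norm, h]

theorem eLpNorm_natCast_pow {α F : Type*} [MeasurableSpace α] [NormedAddCommGroup F]
    (μ : Measure α) (f : α → F) {n : ℕ} (hn : n ≠ 0) :
    eLpNorm f n μ ^ n = ∫⁻ x, ‖f x‖ₑ ^ n ∂μ := by
  have h := eLpNorm_nnreal_pow_eq_lintegral (μ := μ) (f := f) (p := n) (by exact_mod_cast hn)
  simpa using h

theorem eLpNorm_two_sq {α F : Type*} [MeasurableSpace α] [NormedAddCommGroup F]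
    (μ : Measure α) (f : α → F) : eLpNorm f 2 μ ^ 2 = ∫⁻ x, ‖f x‖ₑ ^ 2 ∂μ := by
  simpa using eLpNorm_natCast_pow μ f two_ne_zero

/-- The cube of `𝓕⁻ g` is the inverse transform of `g ⋆ g ⋆ g`, so Plancherel applies. Two weighted
Cauchy–Schwarz steps separate `H`, whose triple convolution is bounded by `K`, from `N`, whose
triple convolution has integral `(∫ N)³`. -/
theorem lintegral_fourierInv_pow_six_le {H N : SpaceTime → ℝ≥0∞} (hH : AEMeasurable H)
    (hN : AEMeasurable N) {K : ℝ≥0∞} (hK : ∀ p, (H ⋆ₗ (H ⋆ₗ H)) p ≤ K) {g : SpaceTime → ℂ}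
    (hg : IntegrableBounded g) (hgN : ∀ q, ‖g q‖ₑ ^ 2 ≤ H q * N q) :
    ∫⁻ x, ‖𝓕⁻ g x‖ₑ ^ 6 ≤ K * (∫⁻ q, N q) ^ 3 := by
  set G := g ⋆[ContinuousLinearMap.mul ℂ ℂ] (g ⋆[ContinuousLinearMap.mul ℂ ℂ] g) with hG
  have hgg := hg.conv hg
  have hGn : IntegrableBounded G := hg.conv hgg
  have h1 : ∫⁻ x, ‖𝓕⁻ g x‖ₑ ^ 6 = eLpNorm (𝓕⁻ G) 2 ^ 2 := by
    rw [eLpNorm_two_sq]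
    refine lintegral_congr fun x => ?_
    rw [hG, fourierInv_conv hg.integrable hgg.integrable,
      fourierInv_conv hg.integrable hg.integrable, enorm_mul, enorm_mul]
    ring
  rw [h1, eLpNorm_fourierInv hGn.integrable hGn.memLp_two, eLpNorm_two_sq]
  have hle : ∀ p, ‖G p‖ₑ ≤ ((fun q => ‖g q‖ₑ) ⋆ₗ ((fun q => ‖g q‖ₑ) ⋆ₗ (fun q => ‖g q‖ₑ))) p := by
    intro p
    refine (enorm_conv_le _ _ p).trans ?_
    simp only [lconvolution_def]
    gcongr with y
    exact enorm_conv_le _ _ _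
  have hHH : AEMeasurable (H ⋆ₗ H) := by fun_prop
  have hNN : AEMeasurable (N ⋆ₗ N) := by fun_prop
  calc ∫⁻ p, ‖G p‖ₑ ^ 2 ≤ ∫⁻ p, K * (N ⋆ₗ (N ⋆ₗ N)) p := by
        refine lintegral_mono fun p => ?_
        refine (pow_le_pow_left' (hle p) 2).trans ?_
        refine (sq_lconvolution_le hH hHH hN hNN hgN
          (fun q => sq_lconvolution_le hH hH hN hN hgN hgN q) p).trans ?_
        gcongr
        exact hK p
    _ = _ := by
        rw [lintegral_const_mul'' _ (by fun_prop), lintegral_lconvolution hN hNN,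
          lintegral_lconvolution hN hN]
        ring

/-! ### Weights on the Fourier side and the `L⁶` Strichartz estimate -/

/-- The Bourgain weight in the frequency variable of Mathlib's Fourier transform. -/
noncomputable def freqWeight (s b : ℝ) (q : SpaceTime) : ℝ := bqWeight s b ((2 * Real.pi) • q)

/-- The weighted `L²` norm on the Fourier side. -/
noncomputable def freqNorm (s b : ℝ) (g : SpaceTime → ℂ) : ℝ≥0∞ :=
  eLpNorm (fun q => freqWeight s b q • g q) 2 volume

@[fun_prop]
theorem continuous_gammaBq : Continuous gammaBq := by
  unfold gammaBq; fun_prop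

@[fun_prop]
theorem continuous_bqWeight (s b : ℝ) : Continuous (bqWeight s b) := by
  unfold bqWeight
  refine Continuous.mul ?_ ?_ <;>
  exact Continuous.rpow_const (by fun_prop) (fun p => Or.inl (bracket_pos _).ne')

@[fun_prop]
theorem continuous_freqWeight (s b : ℝ) : Continuous (freqWeight s b) := by
  unfold freqWeight; fun_prop

theorem bqWeight_pos (s b : ℝ) (p : SpaceTime) : 0 < bqWeight s b p :=
  mul_pos (Real.rpow_pos_of_pos (bracket_pos _) _) (Real.rpow_pos_of_pos (bracket_pos _) _)

theorem freqWeight_pos (s b : ℝ) (q : SpaceTime) : 0 < freqWeight s b q := bqWeight_pos _ _ _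

theorem freqWeight_neg (s b : ℝ) (q : SpaceTime) : freqWeight s b (-q) = freqWeight s b q := by
  simp [freqWeight, bqWeight, bracket, gammaBq, Even.neg_pow (by decide : Even 4)]

theorem freqNorm_mono {s b : ℝ} {f g : SpaceTime → ℂ} (h : ∀ q, ‖f q‖ ≤ ‖g q‖) :
    freqNorm s b f ≤ freqNorm s b g := by
  refine eLpNorm_mono fun q => ?_
  rw [norm_smul, norm_smul]
  exact mul_le_mul_of_nonneg_left (h q) (norm_nonneg _)

theorem freqNorm_comp_neg (s b : ℝ) {g : SpaceTime → ℂ} (hg : AEStronglyMeasurable g) :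
    freqNorm s b (fun q => g (-q)) = freqNorm s b g := by
  have h := eLpNorm_comp_measurePreserving (p := 2)
    (g := fun q => freqWeight s b q • g q)
    ((continuous_freqWeight s b).aestronglyMeasurable.smul hg)
    (Measure.measurePreserving_neg (volume : Measure SpaceTime))
  rw [freqNorm, freqNorm, ← h]
  congr 1
  ext q
  simp [freqWeight_neg]

theorem fourierInv_comp_neg (g : SpaceTime → ℂ) (x : SpaceTime) :
    𝓕⁻ (fun q => g (-q)) x = 𝓕⁻ g (-x) := by
  rw [Real.fourierInv_eq_fourier_comp_neg, Real.fourierInv_eq_fourier_neg]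
  simp

theorem sq_le_gammaBq (ξ : ℝ) : ξ ^ 2 ≤ gammaBq ξ := by
  refine Real.le_sqrt_of_sq_le ?_
  nlinarith [sq_nonneg ξ]

theorem gammaBq_le (ξ : ℝ) : gammaBq ξ ≤ ξ ^ 2 + 1 / 2 := by
  refine Real.sqrt_le_iff.2 ⟨by positivity, ?_⟩
  nlinarith [sq_nonneg ξ]

/-- Replacing `γ(ξ)` by `ξ²` moves the modulation by at most `1/2`, which the `1` in the bracket
absorbs. -/
theorem bracket_sub_sq_le (τ ξ : ℝ) :
    bracket (τ - ξ ^ 2) ≤ 2 * bracket (τ - gammaBq ξ) := by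
  have h1 := sq_le_gammaBq ξ
  have h2 := gammaBq_le ξ
  have h : |τ - ξ ^ 2| ≤ |τ - gammaBq ξ| + |gammaBq ξ - ξ ^ 2| :=
    abs_sub_le _ _ _
  rw [abs_of_nonneg (sub_nonneg.2 h1)] at h
  unfold bracket
  linarith [abs_nonneg (τ - gammaBq ξ)]

/-- The decay profile, in the variable `q 0 - 2 π (q 1) ^ 2`, dominating the inverse square of the
Bourgain weight on the half space of nonnegative time frequencies. -/
noncomputable def modulationProfile (b t : ℝ) : ℝ≥0∞ :=
  ENNReal.ofReal (2 ^ (2 * b)) * bracketDecay (2 * b) ((2 * Real.pi) * t)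

@[fun_prop]
theorem measurable_modulationProfile (b : ℝ) : Measurable (modulationProfile b) := by
  unfold modulationProfile; fun_prop

theorem lintegral_modulationProfile_lt_top {b : ℝ} (hb : 1 / 2 < b) :
    ∫⁻ t, modulationProfile b t < ∞ := by
  unfold modulationProfile
  rw [lintegral_const_mul _ (by fun_prop),
    lintegral_comp_mul_left_real (by fun_prop) (by positivity)]
  exact ENNReal.mul_lt_top ENNReal.ofReal_lt_top (ENNReal.mul_lt_top ENNReal.ofReal_lt_top
    (lintegral_bracketDecay_lt_top (by linarith)))

theorem one_le_modulationProfile_mul {b : ℝ} (hb : 0 ≤ b) {q : SpaceTime} (hq : 0 ≤ q 0) :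
    1 ≤ modulationProfile b (q 0 - (2 * Real.pi) * q 1 ^ 2) * ‖freqWeight 0 b q‖ₑ ^ 2 := by
  have hπ := Real.pi_pos
  set τ := 2 * Real.pi * q 0
  set ξ := 2 * Real.pi * q 1
  have e1 : (2 * Real.pi) * (q 0 - (2 * Real.pi) * q 1 ^ 2) = τ - ξ ^ 2 := by
    simp only [τ, ξ]; ring
  have e2 : freqWeight 0 b q = bracket (τ - gammaBq ξ) ^ b := by
    simp [freqWeight, bqWeight, τ, ξ, abs_of_nonneg (by positivity : 0 ≤ 2 * Real.pi * q 0)]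
  have h1 := bracket_pos (τ - ξ ^ 2)
  have h2 := bracket_pos (τ - gammaBq ξ)
  rw [modulationProfile, e1, e2, bracketDecay, Real.enorm_eq_ofReal (by positivity),
    ← ENNReal.ofReal_pow (by positivity), ← ENNReal.ofReal_mul (by positivity),
    ← ENNReal.ofReal_mul (by positivity), ← ENNReal.ofReal_one]
  refine ENNReal.ofReal_le_ofReal ?_
  rw [← Real.rpow_mul_natCast h2.le, Nat.cast_ofNat, mul_comm b 2, Real.rpow_neg h1.le,
    mul_right_comm, ← Real.mul_rpow (by norm_num) h2.le, ← div_eq_mul_inv,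
    one_le_div (by positivity)]
  exact Real.rpow_le_rpow h1.le (bracket_sub_sq_le τ ξ) (by positivity)

/-- On `τ ≥ 0` the weight sees one paraboloid only. There `|g|²` is at most the profile times the
squared weighted function, and `2b > 1` makes the profile integrable. -/
theorem eLpNorm_six_fourierInv_le_of_support {b : ℝ} (hb : 1 / 2 < b) :
    ∃ C : ℝ≥0, ∀ g : SpaceTime → ℂ, IntegrableBounded g → (∀ q, q 0 < 0 → g q = 0) →
      eLpNorm (𝓕⁻ g) 6 ≤ C * freqNorm 0 b g := by
  set ψ := modulationProfile b
  have hψ : Measurable ψ := measurable_modulationProfile b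
  set K := ENNReal.ofReal (2 / √3) * ENNReal.ofReal (Real.pi / (2 * (2 * Real.pi))) *
    (∫⁻ t, ψ t) ^ 3
  have hK : K < ∞ := ENNReal.mul_lt_top (ENNReal.mul_lt_top ENNReal.ofReal_lt_top
    ENNReal.ofReal_lt_top) (ENNReal.pow_lt_top (lintegral_modulationProfile_lt_top hb))
  have hK6 : K ^ (1 / 6 : ℝ) ≠ ∞ := (ENNReal.rpow_lt_top_of_nonneg (by norm_num) hK.ne).ne
  refine ⟨(K ^ (1 / 6 : ℝ)).toNNReal, fun g hg hsupp => ?_⟩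
  rw [ENNReal.coe_toNNReal hK6]
  have hmeas : AEMeasurable (fun q => ‖freqWeight 0 b q • g q‖ₑ ^ 2) :=
    (((continuous_freqWeight 0 b).aestronglyMeasurable.smul hg.integrable.1).enorm).pow_const 2
  have h := lintegral_fourierInv_pow_six_le
    (H := fun q => ψ (q 0 - (2 * Real.pi) * q 1 ^ 2)) (by fun_prop) hmeas
    (lconvolution_paraboloid_le hψ Real.two_pi_pos) hg (fun q => by
      rcases lt_or_ge (q 0) 0 with hq | hq
      · simp [hsupp q hq]
      · have := one_le_modulationProfile_mul (b := b) (by linarith) hq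
        rw [enorm_smul, mul_pow, ← mul_assoc]
        exact le_mul_of_one_le_left' this)
  rw [← eLpNorm_two_sq] at h
  have h6 := eLpNorm_natCast_pow volume (𝓕⁻ g) (n := 6) (by norm_num)
  rw [← h6] at h
  have e : K * (eLpNorm (fun q => freqWeight 0 b q • g q) 2 volume ^ 2) ^ 3 =
      (K ^ (1 / 6 : ℝ) * freqNorm 0 b g) ^ 6 := by
    rw [mul_pow, ← ENNReal.rpow_natCast (K ^ (1 / 6 : ℝ)), ← ENNReal.rpow_mul, freqNorm]
    norm_num
    ring
  rw [e] at h
  exact (ENNReal.pow_le_pow_left_iff (n := 6) (by norm_num)).1 (by simpa using h)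

/-- The `L⁶` Strichartz estimate. -/
theorem eLpNorm_six_fourierInv_le {b : ℝ} (hb : 1 / 2 < b) :
    ∃ C : ℝ≥0, ∀ g : SpaceTime → ℂ, IntegrableBounded g →
      eLpNorm (𝓕⁻ g) 6 ≤ C * freqNorm 0 b g := by
  obtain ⟨C, hC⟩ := eLpNorm_six_fourierInv_le_of_support hb
  refine ⟨2 * C, fun g hg => ?_⟩
  have hS : MeasurableSet {q : SpaceTime | 0 ≤ q 0} :=
    measurableSet_le measurable_const (by fun_prop)
  set S := {q : SpaceTime | 0 ≤ q 0}
  set g₁ := S.indicator g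
  set g₂ := Sᶜ.indicator g
  have hg₁ : IntegrableBounded g₁ :=
    hg.mono (hg.integrable.1.indicator hS) (fun q => norm_indicator_le_norm_self _ _)
  have hg₂ : IntegrableBounded g₂ :=
    hg.mono (hg.integrable.1.indicator hS.compl) (fun q => norm_indicator_le_norm_self _ _)
  have hsum : g = fun q => g₁ q + g₂ q := by
    ext q
    exact (congrFun (Set.indicator_self_add_compl S g) q).symm
  have hsplit : (𝓕⁻ g : SpaceTime → ℂ) = 𝓕⁻ g₁ + 𝓕⁻ g₂ := by
    conv_lhs => rw [hsum]
    exact fourierInv_add_of_integrable hg₁.integrable hg₂.integrable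
  have b₁ : eLpNorm (𝓕⁻ g₁) 6 ≤ C * freqNorm 0 b g := by
    refine (hC g₁ hg₁ fun q hq => ?_).trans ?_
    · exact Set.indicator_of_notMem (by simpa [S] using hq) _
    · gcongr
      exact freqNorm_mono fun q => norm_indicator_le_norm_self _ _
  have b₂ : eLpNorm (𝓕⁻ g₂) 6 ≤ C * freqNorm 0 b g := by
    -- The reflection `q ↦ -q` carries negative time frequencies to positive ones and preserves both
    -- norms, as the weight is even.
    have h := hC (fun q => g₂ (-q)) hg₂.comp_neg fun q hq => by
      refine Set.indicator_of_notMem ?_ _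
      simpa [S] using hq.le
    rw [freqNorm_comp_neg _ _ hg₂.integrable.1] at h
    have e : eLpNorm (𝓕⁻ fun q => g₂ (-q)) 6 volume = eLpNorm (𝓕⁻ g₂) 6 volume := by
      rw [← eLpNorm_comp_measurePreserving (p := 6)
        (continuous_fourierInv hg₂.integrable).aestronglyMeasurable
        (Measure.measurePreserving_neg (volume : Measure SpaceTime))]
      congr 1
      ext x
      exact fourierInv_comp_neg _ _
    rw [e] at h
    refine h.trans ?_
    gcongr
    exact freqNorm_mono fun q => norm_indicator_le_norm_self _ _
  rw [hsplit]
  refine (eLpNorm_add_le (continuous_fourierInv hg₁.integrable).aestronglyMeasurable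
    (continuous_fourierInv hg₂.integrable).aestronglyMeasurable (by norm_num)).trans ?_
  refine (add_le_add b₁ b₂).trans (le_of_eq ?_)
  push_cast
  ring

/-! ### Frequency-localised bounds and the `L^{6k}` estimate -/

theorem bracketDecay_abs_sub_le (r a c : ℝ) :
    bracketDecay r (|a| - c) ≤ bracketDecay r (a - c) + bracketDecay r (a + c) := by
  rcases le_total 0 a with h | h
  · rw [abs_of_nonneg h]
    exact le_self_add
  · rw [abs_of_nonpos h]
    refine le_trans (le_of_eq ?_) le_add_self
    rw [bracketDecay, bracketDecay, bracket, bracket, ← abs_neg]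
    ring_nf

theorem lintegral_bracketDecay_abs_sub_le (r c : ℝ) :
    ∫⁻ t : ℝ, bracketDecay r (|2 * Real.pi * t| - c) ≤ 2 * ∫⁻ t, bracketDecay r t := by
  have hπ : 0 < 2 * Real.pi := Real.two_pi_pos
  have h1 : ENNReal.ofReal |(2 * Real.pi)⁻¹| ≤ 1 := by
    rw [ENNReal.ofReal_le_one, abs_of_pos (by positivity)]
    exact inv_le_one_of_one_le₀ (by linarith [Real.pi_gt_three])
  calc _ ≤ ∫⁻ t : ℝ, (bracketDecay r (2 * Real.pi * t - c) +
          bracketDecay r (2 * Real.pi * t + c)) :=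
        lintegral_mono fun t => bracketDecay_abs_sub_le _ _ _
    _ = ENNReal.ofReal |(2 * Real.pi)⁻¹| * (∫⁻ t, bracketDecay r t) +
          ENNReal.ofReal |(2 * Real.pi)⁻¹| * (∫⁻ t, bracketDecay r t) := by
        rw [lintegral_add_left (by fun_prop),
          lintegral_comp_mul_left_real (f := fun t => bracketDecay r (t - c)) (by fun_prop) hπ.ne',
          lintegral_comp_mul_left_real (f := fun t => bracketDecay r (t + c)) (by fun_prop) hπ.ne',
          lintegral_sub_right_eq_self, lintegral_add_right_eq_self]
    _ ≤ _ := by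
        rw [← two_mul]
        gcongr
        exact mul_le_of_le_one_left' h1

/-- Cauchy–Schwarz against the inverse squared weight on the strip `|ξ| ≤ R`. The constant `4` is
the product of the length `2R` over `R` and the two branches `τ = ±γ(ξ)`. -/
theorem lintegral_enorm_sq_le {b : ℝ} {g : SpaceTime → ℂ}
    (hg : AEStronglyMeasurable g) {R : ℝ} (hsupp : ∀ q, R < |q 1| → g q = 0) :
    (∫⁻ q, ‖g q‖ₑ) ^ 2 ≤
      ENNReal.ofReal R * (4 * ∫⁻ t, bracketDecay (2 * b) t) * freqNorm 0 b g ^ 2 := by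
  set A : SpaceTime → ℝ≥0∞ := fun q => (Set.Icc (-R) R).indicator 1 (q 1) *
    bracketDecay (2 * b) (|2 * Real.pi * q 0| - gammaBq (2 * Real.pi * q 1)) with hA
  have hi : Measurable ((Set.Icc (-R) R).indicator (1 : ℝ → ℝ≥0∞)) :=
    measurable_one.indicator measurableSet_Icc
  have hAm : Measurable A := by fun_prop
  have hN : AEMeasurable (fun q => ‖freqWeight 0 b q • g q‖ₑ ^ 2) :=
    (((continuous_freqWeight 0 b).aestronglyMeasurable.smul hg).enorm).pow_const 2
  have hint : ∫⁻ q, A q ≤ ENNReal.ofReal R * (4 * ∫⁻ t, bracketDecay (2 * b) t) := by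
    rw [lintegral_spaceTime hAm]
    calc _ ≤ ∫⁻ ξ : ℝ, (Set.Icc (-R) R).indicator 1 ξ * (2 * ∫⁻ t, bracketDecay (2 * b) t) := by
          refine lintegral_mono fun ξ => ?_
          simp only [hA, Matrix.cons_val_zero, Matrix.cons_val_one]
          rw [lintegral_const_mul _ (by fun_prop)]
          gcongr
          exact lintegral_bracketDecay_abs_sub_le _ _
      _ = _ := by
          rw [lintegral_mul_const _ hi, lintegral_indicator_one measurableSet_Icc, Real.volume_Icc,
            show R - -R = 2 * R by ring, ENNReal.ofReal_mul (by norm_num)]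
          rw [ENNReal.ofReal_ofNat]
          ring
  have hpt : ∀ q, ‖g q‖ₑ ≤ A q ^ (1 / 2 : ℝ) * (‖freqWeight 0 b q • g q‖ₑ ^ 2) ^ (1 / 2 : ℝ) := by
    intro q
    rw [← ENNReal.mul_rpow_of_nonneg _ _ (by norm_num), one_div,
      ENNReal.le_rpow_inv_iff (by norm_num), ENNReal.rpow_two]
    rcases lt_or_ge R |q 1| with h | h
    · simp [hsupp q h]
    · have h1 : (Set.Icc (-R) R).indicator (1 : ℝ → ℝ≥0∞) (q 1) = 1 :=
        Set.indicator_of_mem (show q 1 ∈ Set.Icc (-R) R from abs_le.1 h) _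
      have h2 : bracketDecay (2 * b) (|2 * Real.pi * q 0| - gammaBq (2 * Real.pi * q 1)) *
          ‖freqWeight 0 b q‖ₑ ^ 2 = 1 := by
        have hp := bracket_pos (|2 * Real.pi * q 0| - gammaBq (2 * Real.pi * q 1))
        have e2 : freqWeight 0 b q =
            bracket (|2 * Real.pi * q 0| - gammaBq (2 * Real.pi * q 1)) ^ b := by
          simp only [freqWeight, bqWeight, PiLp.smul_apply, smul_eq_mul, Real.rpow_zero, mul_one]
        rw [e2, bracketDecay, Real.enorm_eq_ofReal (by positivity),
          ← ENNReal.ofReal_pow (by positivity), ← ENNReal.ofReal_mul (by positivity),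
          ← Real.rpow_mul_natCast hp.le, Nat.cast_ofNat, mul_comm b 2, ← Real.rpow_add hp]
        simp
      simp only [hA, h1, one_mul]
      rw [enorm_smul, mul_pow, ← mul_assoc, h2, one_mul]
  calc _ ≤ ((∫⁻ q, A q) ^ (1 / 2 : ℝ) *
          (∫⁻ q, ‖freqWeight 0 b q • g q‖ₑ ^ 2) ^ (1 / 2 : ℝ)) ^ 2 := by
        gcongr
        exact (lintegral_mono hpt).trans (ENNReal.lintegral_mul_norm_pow_le hAm.aemeasurable hN
          (by norm_num) (by norm_num) (by norm_num))
    _ = (∫⁻ q, A q) * freqNorm 0 b g ^ 2 := by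
        rw [freqNorm, eLpNorm_two_sq, mul_pow, ← ENNReal.rpow_two, ← ENNReal.rpow_two,
          ← ENNReal.rpow_mul, ← ENNReal.rpow_mul]
        norm_num
    _ ≤ _ := by gcongr

/-- Interpolation by hand: `6k - 6` of the `6k` powers are estimated by the supremum, of size
`R^{1/2}`, and the remaining six by the `L⁶` bound. The exponent is `(6k - 6)/(6k) · 1/2 = 1/2 -
1/(2k)`. -/
theorem eLpNorm_fourierInv_le_of_support {k : ℕ} (hk : 1 ≤ k) {b : ℝ} (hb : 1 / 2 < b) :
    ∃ C : ℝ≥0, ∀ g : SpaceTime → ℂ, IntegrableBounded g → ∀ R : ℝ, 1 ≤ R →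
      (∀ q, R < |q 1| → g q = 0) →
      eLpNorm (𝓕⁻ g) (6 * k : ℕ) ≤
        C * ENNReal.ofReal (R ^ (1 / 2 - 1 / (2 * k) : ℝ)) * freqNorm 0 b g := by
  obtain ⟨C₁, hC₁⟩ := eLpNorm_six_fourierInv_le hb
  set M : ℝ≥0∞ := 4 * ∫⁻ t, bracketDecay (2 * b) t
  have hM : M ≠ ∞ := (ENNReal.mul_lt_top (by norm_num)
    (lintegral_bracketDecay_lt_top (by linarith))).ne
  -- One constant serving both the `L⁶` and the supremum bound.
  set C : ℝ≥0 := max C₁ (M ^ (1 / 2 : ℝ)).toNNReal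
  have hCM : M ≤ (C : ℝ≥0∞) ^ 2 := by
    have h1 : M ^ (1 / 2 : ℝ) ≤ C := by
      rw [← ENNReal.coe_toNNReal (ENNReal.rpow_lt_top_of_nonneg (by norm_num) hM).ne]
      exact_mod_cast le_max_right _ _
    rw [one_div, ENNReal.rpow_inv_le_iff (by norm_num), ENNReal.rpow_two] at h1
    exact h1
  refine ⟨C, fun g hg R hR hsupp => ?_⟩
  have hR0 : 0 ≤ R := by linarith
  set F := freqNorm 0 b g
  obtain ⟨m, rfl⟩ : ∃ m, k = m + 1 := ⟨k - 1, by omega⟩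
  refine (ENNReal.pow_le_pow_left_iff (n := 6 * (m + 1)) (by omega)).1 ?_
  rw [eLpNorm_natCast_pow _ _ (by omega)]
  have hsup : ∀ x, ‖𝓕⁻ g x‖ₑ ^ 2 ≤ ENNReal.ofReal R * C ^ 2 * F ^ 2 := fun x =>
    calc _ ≤ (∫⁻ q, ‖g q‖ₑ) ^ 2 := by gcongr; exact enorm_fourierInv_le g x
      _ ≤ _ := (lintegral_enorm_sq_le (b := b) hg.integrable.1 hsupp).trans (by gcongr)
  have h6 : ∫⁻ x, ‖𝓕⁻ g x‖ₑ ^ 6 ≤ (C * F) ^ 6 := by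
    rw [← eLpNorm_natCast_pow _ _ (by norm_num)]
    gcongr
    refine (hC₁ g hg).trans ?_
    gcongr
    exact le_max_left _ _
  calc ∫⁻ x, ‖𝓕⁻ g x‖ₑ ^ (6 * (m + 1))
      ≤ ∫⁻ x, (ENNReal.ofReal R * C ^ 2 * F ^ 2) ^ (3 * m) * ‖𝓕⁻ g x‖ₑ ^ 6 := by
        refine lintegral_mono fun x => ?_
        rw [show 6 * (m + 1) = 2 * (3 * m) + 6 by ring, pow_add, pow_mul]
        gcongr
        exact hsup x
    _ = (ENNReal.ofReal R * C ^ 2 * F ^ 2) ^ (3 * m) * ∫⁻ x, ‖𝓕⁻ g x‖ₑ ^ 6 :=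
        lintegral_const_mul _
          ((continuous_fourierInv hg.integrable).measurable.enorm.pow_const 6)
    _ ≤ (ENNReal.ofReal R * C ^ 2 * F ^ 2) ^ (3 * m) * (C * F) ^ 6 := by gcongr
    _ = (C * ENNReal.ofReal (R ^ (1 / 2 - 1 / (2 * (m + 1 : ℕ)) : ℝ)) * F) ^ (6 * (m + 1)) := by
        have e : ENNReal.ofReal (R ^ (1 / 2 - 1 / (2 * (m + 1 : ℕ)) : ℝ)) ^ (6 * (m + 1)) =
            ENNReal.ofReal R ^ (3 * m) := by
          rw [← ENNReal.ofReal_pow (by positivity), ← ENNReal.ofReal_pow hR0,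
            ← Real.rpow_mul_natCast hR0, ← Real.rpow_natCast]
          congr 2
          push_cast
          field_simp
          ring
        rw [mul_pow _ F (6 * (m + 1)), mul_pow (C : ℝ≥0∞) (ENNReal.ofReal _) (6 * (m + 1)), e]
        ring

theorem bqWeight_eq (s b : ℝ) (p : SpaceTime) :
    bqWeight s b p = bqWeight 0 b p * bracket (p 1) ^ s := by
  simp [bqWeight]

theorem freqWeight_zero_le {s b : ℝ} (hs : 0 ≤ s) (q : SpaceTime) :
    freqWeight 0 b q ≤ freqWeight s b q := by
  rw [freqWeight, freqWeight, bqWeight_eq s b]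
  exact le_mul_of_one_le_right (bqWeight_pos _ _ _).le (Real.one_le_rpow (one_le_bracket _) hs)

theorem freqNorm_zero_le {s b : ℝ} (hs : 0 ≤ s) (g : SpaceTime → ℂ) :
    freqNorm 0 b g ≤ freqNorm s b g := by
  refine eLpNorm_mono fun q => ?_
  rw [norm_smul, norm_smul, Real.norm_of_nonneg (freqWeight_pos _ _ _).le,
    Real.norm_of_nonneg (freqWeight_pos _ _ _).le]
  exact mul_le_mul_of_nonneg_right (freqWeight_zero_le hs q) (norm_nonneg _)

theorem freqNorm_zero_le_of_support {s b : ℝ} (hs : 0 ≤ s) {g : SpaceTime → ℂ} {L : ℝ}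
    (hL : 0 < L) (h : ∀ q, g q ≠ 0 → L ≤ bracket (2 * Real.pi * q 1)) :
    freqNorm 0 b g ≤ ENNReal.ofReal (L ^ (-s)) * freqNorm s b g := by
  have h1 : freqNorm 0 b g ≤ eLpNorm (L ^ (-s) • fun q => freqWeight s b q • g q) 2 volume := by
    refine eLpNorm_mono fun q => ?_
    by_cases hq : g q = 0
    · simp [hq]
    rw [Pi.smul_apply, norm_smul, norm_smul, norm_smul,
      Real.norm_of_nonneg (freqWeight_pos _ _ _).le,
      Real.norm_of_nonneg (freqWeight_pos _ _ _).le, Real.norm_of_nonneg (by positivity),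
      ← mul_assoc]
    refine mul_le_mul_of_nonneg_right ?_ (norm_nonneg _)
    rw [freqWeight, freqWeight, bqWeight_eq s b, mul_left_comm]
    refine le_mul_of_one_le_right (bqWeight_pos _ _ _).le ?_
    rw [Real.rpow_neg hL.le, inv_mul_eq_div, one_le_div (by positivity)]
    exact Real.rpow_le_rpow hL.le (by simpa using h q hq) hs
  rwa [eLpNorm_const_smul, Real.enorm_of_nonneg (by positivity)] at h1

/-- Each induction step adds the block `2^M ≤ ⟨ξ⟩ < 2^(M+1)`. With `a = 1/2 - 1/(2k)` it costs
`2^((M+1)a)` by localisation and gains `2^(-Ms)` from the weight, hence the ratio `2^(a-s)` and the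
extra constant `2^a`. -/
theorem eLpNorm_fourierInv_indicator_le {k : ℕ} (hk : 1 ≤ k) {s b : ℝ} (hs : 0 ≤ s)
    (hb : 1 / 2 < b) : ∃ C : ℝ≥0, ∀ g : SpaceTime → ℂ, IntegrableBounded g → ∀ M : ℕ,
      eLpNorm (𝓕⁻ ({q : SpaceTime | bracket (2 * Real.pi * q 1) < 2 ^ M}.indicator g))
        (6 * k : ℕ) ≤
      C * ENNReal.ofReal (∑ n ∈ Finset.range M, ((2 : ℝ) ^ (1 / 2 - 1 / (2 * k) - s : ℝ)) ^ n) *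
        freqNorm s b g := by
  obtain ⟨C, hC⟩ := eLpNorm_fourierInv_le_of_support hk hb
  set a : ℝ := 1 / 2 - 1 / (2 * k) with ha
  refine ⟨C * (2 ^ a : ℝ).toNNReal, fun g hg M => ?_⟩
  set S : ℕ → Set SpaceTime := fun M => {q : SpaceTime | bracket (2 * Real.pi * q 1) < 2 ^ M}
    with hS
  have hSm : ∀ M, MeasurableSet (S M) := fun M =>
    measurableSet_lt (by fun_prop) measurable_const
  change eLpNorm (𝓕⁻ ((S M).indicator g)) _ _ ≤ _
  induction M with
  | zero =>
    have h0 : S 0 = ∅ := by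
      ext q
      simpa [hS] using one_le_bracket _
    rw [h0, Set.indicator_empty]
    have : (𝓕⁻ (fun _ => 0 : SpaceTime → ℂ) : SpaceTime → ℂ) = 0 := by
      ext x
      simp [Real.fourierInv_eq]
    rw [this]
    simp
  | succ M ih =>
    set D := S (M + 1) \ S M
    have hDm : MeasurableSet D := (hSm _).diff (hSm _)
    have hsub : S M ⊆ S (M + 1) := fun q hq =>
      lt_of_lt_of_le (show bracket _ < 2 ^ M from hq) (by gcongr <;> norm_num)
    have hdec : (S (M + 1)).indicator g =
        fun q => (S M).indicator g q + D.indicator g q := by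
      have := Set.indicator_union_of_disjoint (f := g)
        (Set.disjoint_sdiff_right : Disjoint (S M) D)
      rwa [Set.union_sdiff_cancel hsub] at this
    have hgS : ∀ T : Set SpaceTime, MeasurableSet T → IntegrableBounded (T.indicator g) :=
      fun T hT => hg.mono (hg.integrable.1.indicator hT) fun q => norm_indicator_le_norm_self _ _
    have hblock : eLpNorm (𝓕⁻ (D.indicator g)) (6 * k : ℕ) ≤
        (C * (2 ^ a : ℝ).toNNReal : ℝ≥0) * ENNReal.ofReal (((2 : ℝ) ^ (a - s)) ^ M) *
          freqNorm s b g := by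
      refine (hC _ (hgS D hDm) (2 ^ (M + 1)) (one_le_pow₀ (by norm_num)) fun q hq => ?_).trans ?_
      · refine Set.indicator_of_notMem (fun hD => ?_) _
        have h1 : bracket (2 * Real.pi * q 1) < 2 ^ (M + 1) := hD.1
        rw [bracket, abs_mul, abs_of_pos Real.two_pi_pos] at h1
        nlinarith [Real.pi_gt_three, abs_nonneg (q 1)]
      · have h2 : freqNorm 0 b (D.indicator g) ≤
            ENNReal.ofReal ((2 ^ M : ℝ) ^ (-s)) * freqNorm s b g := by
          refine (freqNorm_zero_le_of_support hs (L := 2 ^ M) (by positivity) fun q hq => ?_).trans ?_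
          · have : q ∈ D := Set.mem_of_indicator_ne_zero hq
            exact not_lt.1 this.2
          · gcongr
            exact freqNorm_mono fun q => norm_indicator_le_norm_self _ _
        refine (mul_le_mul' le_rfl h2).trans (le_of_eq ?_)
        have e : ENNReal.ofReal ((2 ^ (M + 1) : ℝ) ^ a) * ENNReal.ofReal ((2 ^ M : ℝ) ^ (-s)) =
            ENNReal.ofReal (2 ^ a) * ENNReal.ofReal (((2 : ℝ) ^ (a - s)) ^ M) := by
          rw [← ENNReal.ofReal_mul (by positivity), ← ENNReal.ofReal_mul (by positivity)]
          congr 1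
          rw [← Real.rpow_natCast, ← Real.rpow_natCast, ← Real.rpow_natCast,
            ← Real.rpow_mul (by norm_num), ← Real.rpow_mul (by norm_num),
            ← Real.rpow_mul (by norm_num), ← Real.rpow_add (by norm_num),
            ← Real.rpow_add (by norm_num)]
          congr 1
          push_cast
          ring
        rw [← mul_assoc, mul_assoc (C : ℝ≥0∞), e, ENNReal.coe_mul, ← mul_assoc (C : ℝ≥0∞)]
        rfl
    rw [hdec, fourierInv_add_of_integrable (hgS _ (hSm _)).integrable (hgS _ hDm).integrable]
    refine (eLpNorm_add_le (continuous_fourierInv (hgS _ (hSm _)).integrable).aestronglyMeasurable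
      (continuous_fourierInv (hgS _ hDm).integrable).aestronglyMeasurable
      (by exact_mod_cast (by omega : 1 ≤ 6 * k))).trans ?_
    rw [Finset.sum_range_succ, ENNReal.ofReal_add (Finset.sum_nonneg fun _ _ => by positivity)
      (by positivity), mul_add, add_mul]
    exact add_le_add ih hblock

/-- The `L^{6k}` bound, by interpolation of the `L⁶` Strichartz estimate with the trivial `L^∞`
bound on dyadic blocks. -/
theorem eLpNorm_fourierInv_le {k : ℕ} (hk : 1 ≤ k) {s b : ℝ} (hs : 0 ≤ s)
    (hks : k = 1 ∨ (1 / 2 - 1 / (2 * k) : ℝ) < s) (hb : 1 / 2 < b) :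
    ∃ C : ℝ≥0, ∀ g : SpaceTime → ℂ, IntegrableBounded g →
      (∃ R : ℝ, ∀ q : SpaceTime, R < ‖q‖ → g q = 0) →
      eLpNorm (𝓕⁻ g) (6 * k : ℕ) ≤ C * freqNorm s b g := by
  rcases hks with rfl | hks
  -- For `k = 1` the exponent is `6` and no derivative is lost, so `s = 0` is allowed.
  · obtain ⟨C, hC⟩ := eLpNorm_six_fourierInv_le hb
    refine ⟨C, fun g hg _ => ?_⟩
    refine le_trans (by simpa using hC g hg) ?_
    gcongr
    exact freqNorm_zero_le hs g
  · obtain ⟨C, hC⟩ := eLpNorm_fourierInv_indicator_le hk hs hb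
    set r : ℝ := (2 : ℝ) ^ (1 / 2 - 1 / (2 * k) - s : ℝ)
    have hr0 : 0 ≤ r := by positivity
    have hr1 : r < 1 := Real.rpow_lt_one_of_one_lt_of_neg (by norm_num) (by linarith)
    refine ⟨C * ((1 - r)⁻¹).toNNReal, fun g hg ⟨R, hR⟩ => ?_⟩
    -- `M` depends on the support of `g`, but the geometric series bounds the partial sums uniformly
    -- in `M`.
    obtain ⟨M, hM⟩ := pow_unbounded_of_one_lt (1 + 2 * Real.pi * R) (one_lt_two : (1 : ℝ) < 2)
    have h := hC g hg M
    have e : {q : SpaceTime | bracket (2 * Real.pi * q 1) < 2 ^ M}.indicator g = g := by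
      refine Set.indicator_eq_self.2 fun q hq => ?_
      have h1 : ‖q‖ ≤ R := not_lt.1 fun h => hq (hR q h)
      have h2 : |q 1| ≤ ‖q‖ := by simpa using PiLp.norm_apply_le q 1
      change bracket _ < _
      rw [bracket, abs_mul, abs_of_pos Real.two_pi_pos]
      nlinarith [Real.pi_gt_three]
    rw [e] at h
    refine h.trans ?_
    rw [ENNReal.coe_mul]
    gcongr
    change _ ≤ ENNReal.ofReal _
    refine ENNReal.ofReal_le_ofReal ?_
    rw [← tsum_geometric_of_lt_one hr0 hr1]
    exact (summable_geometric_of_lt_one hr0 hr1).sum_le_tsum _ fun _ _ => by positivity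

/-! ### Convolution powers and the Leibniz rule -/

theorem ofReal_conv (f g : SpaceTime → ℝ) :
    (fun x => (((f ⋆[ContinuousLinearMap.mul ℝ ℝ] g) x : ℝ) : ℂ)) =
      (fun x => (f x : ℂ)) ⋆[ContinuousLinearMap.mul ℂ ℂ] (fun x => (g x : ℂ)) := by
  ext x
  simp only [MeasureTheory.convolution, ContinuousLinearMap.mul_apply']
  rw [← integral_complex_ofReal]
  simp

theorem norm_conv_le_conv {f g : SpaceTime → ℂ} {F G : SpaceTime → ℝ}
    (hF : IntegrableBounded F) (hG : IntegrableBounded G) (hf : ∀ x, ‖f x‖ ≤ F x)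
    (hg : ∀ x, ‖g x‖ ≤ G x) (x : SpaceTime) :
    ‖(f ⋆[ContinuousLinearMap.mul ℂ ℂ] g) x‖ ≤ (F ⋆[ContinuousLinearMap.mul ℝ ℝ] G) x := by
  refine norm_integral_le_of_norm_le (hF.convolutionExists hG x) (.of_forall fun t => ?_)
  simp only [ContinuousLinearMap.mul_apply', norm_mul]
  exact mul_le_mul (hf _) (hg _) (norm_nonneg _) ((norm_nonneg _).trans (hf _))

/-- The `(n + 1)`-fold convolution power of `G`. -/
noncomputable def convPower (G : SpaceTime → ℝ) : ℕ → SpaceTime → ℝ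
  | 0 => G
  | n + 1 => G ⋆[ContinuousLinearMap.mul ℝ ℝ] convPower G n

/-- The sum, over the factors of the `(n + 1)`-fold convolution power of `G`, of the convolutions
in which that factor is replaced by `G₀`. -/
noncomputable def convPowerDeriv (G₀ G : SpaceTime → ℝ) : ℕ → SpaceTime → ℝ
  | 0 => G₀
  | n + 1 => fun x => (G₀ ⋆[ContinuousLinearMap.mul ℝ ℝ] convPower G n) x +
      (G ⋆[ContinuousLinearMap.mul ℝ ℝ] convPowerDeriv G₀ G n) x

section

variable {G₀ G : SpaceTime → ℝ}

theorem IntegrableBounded.convPower (hG : IntegrableBounded G) (n : ℕ) :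
    IntegrableBounded (convPower G n) := by
  induction n with
  | zero => exact hG
  | succ n ih => exact hG.conv ih

theorem IntegrableBounded.convPowerDeriv (hG₀ : IntegrableBounded G₀) (hG : IntegrableBounded G)
    (n : ℕ) : IntegrableBounded (convPowerDeriv G₀ G n) := by
  induction n with
  | zero => exact hG₀
  | succ n ih => exact (hG₀.conv (hG.convPower n)).add (hG.conv ih)

theorem conv_nonneg {f g : SpaceTime → ℝ} (hf : ∀ x, 0 ≤ f x) (hg : ∀ x, 0 ≤ g x)
    (x : SpaceTime) : 0 ≤ (f ⋆[ContinuousLinearMap.mul ℝ ℝ] g) x :=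
  integral_nonneg fun _ => mul_nonneg (hf _) (hg _)

theorem convPower_nonneg (hG : ∀ x, 0 ≤ G x) (n : ℕ) (x : SpaceTime) : 0 ≤ convPower G n x := by
  induction n generalizing x with
  | zero => exact hG x
  | succ n ih => exact conv_nonneg hG ih x

theorem fourierInv_convPower (hG : IntegrableBounded G) (n : ℕ) (x : SpaceTime) :
    𝓕⁻ (fun q => (convPower G n q : ℂ)) x = 𝓕⁻ (fun q => (G q : ℂ)) x ^ (n + 1) := by
  induction n with
  | zero => simp [convPower]
  | succ n ih =>
    simp only [convPower]
    rw [ofReal_conv, fourierInv_conv hG.ofReal.integrable (hG.convPower n).ofReal.integrable, ih,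
      ← pow_succ']

/-- On the physical side products commute, so the `n + 1` terms coincide. -/
theorem fourierInv_convPowerDeriv (hG₀ : IntegrableBounded G₀) (hG : IntegrableBounded G)
    (n : ℕ) (x : SpaceTime) :
    𝓕⁻ (fun q => (convPowerDeriv G₀ G n q : ℂ)) x =
      (n + 1) * (𝓕⁻ (fun q => (G₀ q : ℂ)) x * 𝓕⁻ (fun q => (G q : ℂ)) x ^ n) := by
  induction n with
  | zero => simp [convPowerDeriv]
  | succ n ih =>
    have hP := hG.convPower n
    have hT := hG₀.convPowerDeriv hG n
    simp only [convPowerDeriv, Complex.ofReal_add]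
    rw [fourierInv_add_of_integrable (hG₀.conv hP).ofReal.integrable (hG.conv hT).ofReal.integrable,
      Pi.add_apply, ofReal_conv, ofReal_conv,
      fourierInv_conv hG₀.ofReal.integrable hP.ofReal.integrable,
      fourierInv_conv hG.ofReal.integrable hT.ofReal.integrable, ih, fourierInv_convPower hG]
    push_cast
    ring

/-- The Leibniz rule for a weight that is subadditive up to a constant. -/
theorem mul_convPower_le {J : SpaceTime → ℝ} (hJ0 : ∀ x, 0 ≤ J x) {c : ℝ} (hc : 1 ≤ c)
    (hJ : ∀ x y, J (x + y) ≤ c * (J x + J y)) (hG0 : ∀ x, 0 ≤ G x)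
    (hG : IntegrableBounded G) (hJG : IntegrableBounded (fun x => J x * G x)) (n : ℕ)
    (x : SpaceTime) :
    J x * convPower G n x ≤ c ^ n * convPowerDeriv (fun x => J x * G x) G n x := by
  induction n generalizing x with
  | zero => simp [convPower, convPowerDeriv]
  | succ n ih =>
    have hP := hG.convPower n
    have hT := hJG.convPowerDeriv hG n
    have i0 : Integrable fun t => G t * convPower G n (x - t) := hG.convolutionExists hP x
    have i1 : Integrable fun t => (J t * G t) * convPower G n (x - t) :=
      hJG.convolutionExists hP x
    have i2 : Integrable fun t => G t * convPowerDeriv (fun x => J x * G x) G n (x - t) :=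
      hG.convolutionExists hT x
    simp only [convPower, convPowerDeriv, MeasureTheory.convolution,
      ContinuousLinearMap.mul_apply']
    rw [← integral_add i1 i2, ← integral_const_mul, ← integral_const_mul]
    refine integral_mono (i0.const_mul _) ((i1.add i2).const_mul _) fun t => ?_
    have h1 : J x ≤ c * (J t + J (x - t)) := by simpa using hJ t (x - t)
    have h2 := ih (x - t)
    have h3 := convPower_nonneg hG0 n (x - t)
    have h4 : 1 ≤ c ^ n := one_le_pow₀ hc
    have h5 : 0 ≤ J t * G t * convPower G n (x - t) :=
      mul_nonneg (mul_nonneg (hJ0 t) (hG0 t)) h3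
    calc J x * (G t * convPower G n (x - t))
        ≤ c * (J t + J (x - t)) * (G t * convPower G n (x - t)) :=
          mul_le_mul_of_nonneg_right h1 (mul_nonneg (hG0 t) h3)
      _ = c * (1 * (J t * G t * convPower G n (x - t)) +
            G t * (J (x - t) * convPower G n (x - t))) := by ring
      -- The first term is enlarged by `c ^ n ≥ 1` so that both carry the factor `c ^ (n + 1)`.
      _ ≤ c * (c ^ n * (J t * G t * convPower G n (x - t)) +
            G t * (c ^ n * convPowerDeriv (fun x => J x * G x) G n (x - t))) := by
          gcongr
          exact hG0 t
      _ = _ := by ring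

end

/-- The Fourier transform of `|u| ^ (2 j) u`, where `g` is the Fourier transform of `u`. -/
noncomputable def convNonlinearity (g : SpaceTime → ℂ) : ℕ → SpaceTime → ℂ
  | 0 => g
  | j + 1 => g ⋆[ContinuousLinearMap.mul ℂ ℂ] ((fun x => starRingEnd ℂ (g (-x)))
      ⋆[ContinuousLinearMap.mul ℂ ℂ] convNonlinearity g j)

theorem IntegrableBounded.convNonlinearity {g : SpaceTime → ℂ} (hg : IntegrableBounded g) (j : ℕ) :
    IntegrableBounded (convNonlinearity g j) := by
  induction j with
  | zero => exact hg
  | succ j ih => exact hg.conv (hg.star_comp_neg.conv ih)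

theorem fourierInv_star_comp_neg (g : SpaceTime → ℂ) (x : SpaceTime) :
    𝓕⁻ (fun q => starRingEnd ℂ (g (-q))) x = starRingEnd ℂ (𝓕⁻ g x) := by
  rw [fourierInv_comp_neg (fun q => starRingEnd ℂ (g q)), Real.fourierInv_eq', Real.fourierInv_eq',
    ← integral_conj]
  refine integral_congr_ae (.of_forall fun v => ?_)
  simp [← Complex.exp_conj, Complex.conj_ofNat]

theorem fourierInv_convNonlinearity {g : SpaceTime → ℂ} (hg : IntegrableBounded g) (j : ℕ)
    (x : SpaceTime) : 𝓕⁻ (convNonlinearity g j) x = powerNonlinearity j (𝓕⁻ g) x := by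
  induction j with
  | zero => simp [convNonlinearity, powerNonlinearity]
  | succ j ih =>
    have h := hg.convNonlinearity j
    rw [convNonlinearity, fourierInv_conv hg.integrable (hg.star_comp_neg.conv h).integrable,
      fourierInv_conv hg.star_comp_neg.integrable h.integrable, ih, fourierInv_star_comp_neg,
      ← mul_assoc, Complex.mul_conj, Complex.normSq_eq_norm_sq, powerNonlinearity,
      powerNonlinearity]
    push_cast
    ring

/-- A majorant of both `g` and its reflection makes conjugated and unconjugated factors
indistinguishable, leaving a plain convolution power. -/
theorem norm_convNonlinearity_le {g : SpaceTime → ℂ} {G : SpaceTime → ℝ}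
    (hG : IntegrableBounded G) (h1 : ∀ q, ‖g q‖ ≤ G q) (h2 : ∀ q, ‖g (-q)‖ ≤ G q) (j : ℕ)
    (x : SpaceTime) : ‖convNonlinearity g j x‖ ≤ convPower G (2 * j) x := by
  induction j generalizing x with
  | zero => exact h1 x
  | succ j ih =>
    have hP := hG.convPower (2 * j)
    exact norm_conv_le_conv hG (hG.conv hP) h1
      (norm_conv_le_conv hG hP (fun q => by simpa using h2 q) ih) x

/-! ### The nonlinear estimate for compactly supported frequencies -/

theorem bracket_rpow_add_le {s : ℝ} (hs : 0 ≤ s) (x y : ℝ) :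
    bracket (x + y) ^ s ≤ 2 ^ s * (bracket x ^ s + bracket y ^ s) := by
  have hx := bracket_pos x
  have hy := bracket_pos y
  have hxy := bracket_pos (x + y)
  have h : bracket (x + y) ≤ 2 * max (bracket x) (bracket y) := by
    have h1 := abs_add_le x y
    have h2 := le_max_left (bracket x) (bracket y)
    have h3 := le_max_right (bracket x) (bracket y)
    unfold bracket at *
    linarith
  calc _ ≤ (2 * max (bracket x) (bracket y)) ^ s := Real.rpow_le_rpow hxy.le h hs
    _ = 2 ^ s * max (bracket x) (bracket y) ^ s := Real.mul_rpow (by norm_num) (by positivity)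
    _ ≤ _ := by
        gcongr
        rcases max_cases (bracket x) (bracket y) with h | h <;> rw [h.1]
        · exact le_add_of_nonneg_right (by positivity)
        · exact le_add_of_nonneg_left (by positivity)

theorem freqWeight_zero_right (s : ℝ) (q : SpaceTime) :
    freqWeight s 0 q = bracket (2 * Real.pi * q 1) ^ s := by
  simp [freqWeight, bqWeight]

theorem freqWeight_add_le {s : ℝ} (hs : 0 ≤ s) (x y : SpaceTime) :
    freqWeight s 0 (x + y) ≤ 2 ^ s * (freqWeight s 0 x + freqWeight s 0 y) := by
  simp only [freqWeight_zero_right, PiLp.add_apply, mul_add (2 * Real.pi)]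
  exact bracket_rpow_add_le hs _ _

theorem freqWeight_eq_mul (s b : ℝ) (q : SpaceTime) :
    freqWeight s b q = freqWeight 0 b q * freqWeight s 0 q := by
  simp [freqWeight, bqWeight]

theorem IntegrableBounded.freqWeight_mul {G : SpaceTime → ℝ} (hG : IntegrableBounded G)
    {R : ℝ} (hR : ∀ q, R < ‖q‖ → G q = 0) (s b : ℝ) :
    IntegrableBounded (fun q => freqWeight s b q * G q) := by
  obtain ⟨C, hC⟩ := (isCompact_closedBall (0 : SpaceTime) R).exists_bound_of_continuousOn
    (continuous_freqWeight s b).continuousOn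
  refine (hG.const_mul C).mono ((continuous_freqWeight s b).aestronglyMeasurable.mul
    hG.integrable.1) fun q => ?_
  rcases lt_or_ge R ‖q‖ with h | h
  · simp [hR q h]
  · rw [norm_mul, norm_mul]
    gcongr
    exact (hC q (by simpa using h)).trans (Real.le_norm_self C)

theorem holderTriple_six_three_two : ENNReal.HolderTriple 6 3 2 := ⟨by
  rw [← ENNReal.toReal_eq_toReal_iff' (by simp) (by simp),
    ENNReal.toReal_add (by simp) (by simp)]
  norm_num⟩

theorem eLpNorm_two_mul_le {f g : SpaceTime → ℂ} (hf : AEStronglyMeasurable f)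
    (hg : AEStronglyMeasurable g) :
    eLpNorm (fun x => f x * g x) 2 ≤ eLpNorm f 6 * eLpNorm g 3 := by
  have := holderTriple_six_three_two
  have h := eLpNorm_le_eLpNorm_mul_eLpNorm_of_nnnorm (p := 6) (q := 3) (r := 2) hf hg
    (fun a b => a * b) 1 (.of_forall fun x => by simp)
  simpa using h

/-- Hölder with `1/2 = 1/6 + 1/3`; the `L³` norm of a `2k`-th power is what calls for the exponent
`6k`. -/
theorem eLpNorm_mul_pow_le {V₀ V : SpaceTime → ℂ} (h₀ : AEStronglyMeasurable V₀)
    (h : AEStronglyMeasurable V) {k : ℕ} (hk : 1 ≤ k) :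
    eLpNorm (fun x => V₀ x * V x ^ (2 * k)) 2 ≤
      eLpNorm V₀ 6 * eLpNorm V (6 * k : ℕ) ^ (2 * k) := by
  have h1 : eLpNorm (fun x => V x ^ (2 * k)) 3 = eLpNorm V (6 * k : ℕ) ^ (2 * k) := by
    have e1 := eLpNorm_natCast_pow volume (fun x => V x ^ (2 * k)) (n := 3) (by norm_num)
    have e2 := eLpNorm_natCast_pow volume V (n := 6 * k) (by omega)
    have e3 : eLpNorm (fun x => V x ^ (2 * k)) 3 ^ 3 =
        (eLpNorm V (6 * k : ℕ) ^ (2 * k)) ^ 3 := by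
      rw [← pow_mul, show 2 * k * 3 = 6 * k by ring, e2]
      refine Eq.trans (by simpa using e1) (lintegral_congr fun x => ?_)
      rw [← pow_mul]
      ring_nf
    exact (ENNReal.pow_right_strictMono (n := 3) (by norm_num)).injective e3
  rw [← h1]
  exact eLpNorm_two_mul_le h₀ (h.pow (2 * k))

theorem freqNorm_convNonlinearity_le {k : ℕ} (hk : 1 ≤ k) {s b : ℝ} (hs : 0 ≤ s)
    (hks : k = 1 ∨ (1 / 2 - 1 / (2 * k) : ℝ) < s) (hb : 1 / 2 < b) :
    ∃ C : ℝ≥0, ∀ g : SpaceTime → ℂ, IntegrableBounded g →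
      (∃ R : ℝ, ∀ q : SpaceTime, R < ‖q‖ → g q = 0) →
      freqNorm s 0 (convNonlinearity g k) ≤ C * freqNorm s b g ^ (2 * k + 1) := by
  obtain ⟨C₀, hC₀⟩ := eLpNorm_six_fourierInv_le hb
  obtain ⟨C₁, hC₁⟩ := eLpNorm_fourierInv_le hk hs hks hb
  -- `(2^s)^(2k)` comes from the Leibniz rule and `2k + 1` from the choice of the factor that
  -- carries the weight.
  set c : ℝ≥0 := ((2 : ℝ) ^ s).toNNReal ^ (2 * k) * (2 * k + 1 : ℕ) with hc
  refine ⟨c * (C₀ * C₁ ^ (2 * k) * 2 ^ (2 * k + 1)), fun g hg ⟨R, hR⟩ => ?_⟩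
  set G : SpaceTime → ℝ := fun q => ‖g q‖ + ‖g (-q)‖ with hGdef
  have hG : IntegrableBounded G := hg.norm.add hg.comp_neg.norm
  have hG0 : ∀ q, 0 ≤ G q := fun q => by positivity
  have hGR : ∀ q, R < ‖q‖ → G q = 0 := fun q hq => by
    simp [hGdef, hR q hq, hR (-q) (by simpa using hq)]
  set G₀ : SpaceTime → ℝ := fun q => freqWeight s 0 q * G q with hG₀def
  have hG₀ : IntegrableBounded G₀ := hG.freqWeight_mul hGR s 0
  have hGnorm : freqNorm s b (fun q => (G q : ℂ)) ≤ 2 * freqNorm s b g := by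
    have hm := (continuous_freqWeight s b).aestronglyMeasurable (μ := volume)
    have h1 : freqNorm s b (fun q => (G q : ℂ)) =
        eLpNorm ((fun q => ‖freqWeight s b q • g q‖) +
          fun q => ‖freqWeight s b q • g (-q)‖) 2 volume := by
      refine eLpNorm_congr_norm_ae (.of_forall fun q => ?_)
      simp only [Pi.add_apply, norm_smul]
      rw [← mul_add, Complex.norm_real, Real.norm_of_nonneg (hG0 q), norm_mul, norm_norm,
        Real.norm_of_nonneg (by positivity : 0 ≤ ‖g q‖ + ‖g (-q)‖)]
    rw [h1]
    refine (eLpNorm_add_le (hm.smul hg.integrable.1).norm (hm.smul hg.comp_neg.integrable.1).norm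
      (by norm_num)).trans (le_of_eq ?_)
    rw [eLpNorm_norm, eLpNorm_norm, two_mul]
    congr 1
    exact freqNorm_comp_neg s b hg.integrable.1
  -- The weight `⟨ξ⟩ ^ s` is already inside `G₀`, so Strichartz without derivatives returns the full
  -- norm of `G`.
  have hV₀ : eLpNorm (𝓕⁻ fun q => (G₀ q : ℂ)) 6 ≤ C₀ * (2 * freqNorm s b g) := by
    refine (hC₀ _ hG₀.ofReal).trans ?_
    gcongr
    refine le_trans (le_of_eq ?_) hGnorm
    refine congrArg (eLpNorm · 2 volume) (funext fun q => ?_)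
    rw [freqWeight_eq_mul s b q, hG₀def, mul_smul]
    simp
  have hV : eLpNorm (𝓕⁻ fun q => (G q : ℂ)) (6 * k : ℕ) ≤ C₁ * (2 * freqNorm s b g) := by
    refine (hC₁ _ hG.ofReal ⟨R, fun q hq => by simp [hGR q hq]⟩).trans ?_
    gcongr
  set T := convPowerDeriv G₀ G (2 * k) with hT
  have hTn : IntegrableBounded T := hG₀.convPowerDeriv hG _
  have h2s : (1 : ℝ) ≤ 2 ^ s := Real.one_le_rpow (by norm_num) hs
  have hpt : ∀ q, freqWeight s 0 q * ‖convNonlinearity g k q‖ ≤ (2 ^ s) ^ (2 * k) * T q := by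
    intro q
    have h1 := norm_convNonlinearity_le hG (fun q => le_add_of_nonneg_right (norm_nonneg _))
      (fun q => le_add_of_nonneg_left (norm_nonneg _)) k q
    have h2 := mul_convPower_le (J := freqWeight s 0) (fun x => (freqWeight_pos _ _ _).le) h2s
      (freqWeight_add_le hs) hG0 hG hG₀ (2 * k) q
    exact (mul_le_mul_of_nonneg_left h1 (freqWeight_pos _ _ _).le).trans h2
  have hTL2 : eLpNorm (fun q => (T q : ℂ)) 2 ≤
      (2 * k + 1 : ℕ) * (eLpNorm (𝓕⁻ fun q => (G₀ q : ℂ)) 6 *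
        eLpNorm (𝓕⁻ fun q => (G q : ℂ)) (6 * k : ℕ) ^ (2 * k)) := by
    rw [← eLpNorm_fourierInv hTn.ofReal.integrable hTn.ofReal.memLp_two]
    have e : (𝓕⁻ (fun q => (T q : ℂ)) : SpaceTime → ℂ) = ((2 * k + 1 : ℕ) : ℂ) •
        fun x => 𝓕⁻ (fun q => (G₀ q : ℂ)) x * 𝓕⁻ (fun q => (G q : ℂ)) x ^ (2 * k) := by
      ext x
      rw [hT, fourierInv_convPowerDeriv hG₀ hG]
      simp
    rw [e, eLpNorm_const_smul]
    refine mul_le_mul' (le_of_eq ?_) (eLpNorm_mul_pow_le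
      (continuous_fourierInv hG₀.ofReal.integrable).aestronglyMeasurable
      (continuous_fourierInv hG.ofReal.integrable).aestronglyMeasurable hk)
    rw [← ofReal_norm, Complex.norm_natCast, ENNReal.ofReal_natCast]
  have hD : freqNorm s 0 (convNonlinearity g k) ≤
      ENNReal.ofReal ((2 ^ s) ^ (2 * k)) * eLpNorm (fun q => (T q : ℂ)) 2 := by
    have h1 : freqNorm s 0 (convNonlinearity g k) ≤
        eLpNorm (((2 : ℝ) ^ s) ^ (2 * k) • fun q => (T q : ℂ)) 2 volume := by
      refine eLpNorm_mono fun q => ?_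
      rw [Pi.smul_apply, norm_smul, norm_smul, Real.norm_of_nonneg (freqWeight_pos _ _ _).le,
        Real.norm_of_nonneg (by positivity), Complex.norm_real]
      exact (hpt q).trans (mul_le_mul_of_nonneg_left (Real.le_norm_self _) (by positivity))
    rwa [eLpNorm_const_smul, Real.enorm_of_nonneg (by positivity)] at h1
  calc _ ≤ ENNReal.ofReal ((2 ^ s) ^ (2 * k)) * ((2 * k + 1 : ℕ) * ((C₀ * (2 * freqNorm s b g)) *
          (C₁ * (2 * freqNorm s b g)) ^ (2 * k))) := by
        refine hD.trans ?_
        gcongr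
        refine hTL2.trans ?_
        gcongr
    _ = _ := by
        rw [hc, ENNReal.ofReal_pow (by positivity), ENNReal.ofReal]
        push_cast
        ring

/-! ### Rescaling of the norm and `L^{4k+2}` continuity of the nonlinearity -/

theorem one_le_freqWeight {s b : ℝ} (hs : 0 ≤ s) (hb : 0 ≤ b) (q : SpaceTime) :
    1 ≤ freqWeight s b q :=
  one_le_mul_of_one_le_of_one_le (Real.one_le_rpow (one_le_bracket _) hb)
    (Real.one_le_rpow (one_le_bracket _) hs)

theorem eLpNorm_two_le_freqNorm {s b : ℝ} (hs : 0 ≤ s) (hb : 0 ≤ b) (g : SpaceTime → ℂ) :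
    eLpNorm g 2 ≤ freqNorm s b g := by
  refine eLpNorm_mono fun q => ?_
  rw [norm_smul, Real.norm_of_nonneg (freqWeight_pos _ _ _).le]
  exact le_mul_of_one_le_left (norm_nonneg _) (one_le_freqWeight hs hb q)

/-- The change of variables `p = 2πq` in dimension two has Jacobian `(2π)²`, whose square root
appears. -/
theorem xNorm_eq (s b : ℝ) (u : L2ST) :
    xNorm s b u = ENNReal.ofReal (2 * Real.pi) * freqNorm s b ((𝓕 u : L2ST) : SpaceTime → ℂ) := by
  have hπ : 2 * Real.pi ≠ 0 := Real.two_pi_pos.ne'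
  set f : SpaceTime → ℂ := fun q => freqWeight s b q • ((𝓕 u : L2ST) : SpaceTime → ℂ) q with hf
  have h1 : xNorm s b u = eLpNorm (fun p => f ((2 * Real.pi)⁻¹ • p)) 2 volume := by
    refine congrArg (eLpNorm · 2 volume) (funext fun p => ?_)
    simp only [hf, stFourier, freqWeight]
    rw [smul_inv_smul₀ hπ]
  refine (ENNReal.pow_right_strictMono (n := 2) (by norm_num)).injective ?_
  rw [h1, mul_pow, freqNorm, eLpNorm_two_sq, eLpNorm_two_sq]
  have h2 := lintegral_map_equiv (μ := (volume : Measure SpaceTime)) (fun q => ‖f q‖ₑ ^ 2)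
    (MeasurableEquiv.smul₀ (2 * Real.pi)⁻¹ (inv_ne_zero hπ))
  rw [MeasurableEquiv.coe_smul₀, Measure.map_addHaar_smul _ (inv_ne_zero hπ),
    lintegral_smul_measure, smul_eq_mul] at h2
  rw [← h2, finrank_euclideanSpace_fin, inv_pow, inv_inv, abs_of_pos (by positivity),
    ENNReal.ofReal_pow (by positivity)]

theorem enorm_powerNonlinearity (k : ℕ) (u : SpaceTime → ℂ) (x : SpaceTime) :
    ‖powerNonlinearity k u x‖ₑ = ‖u x‖ₑ ^ (2 * k + 1) := by
  rw [← enorm_pow, enorm_eq_iff_norm_eq, powerNonlinearity, norm_mul, Complex.norm_real,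
    norm_pow, norm_pow, norm_norm, pow_succ]

theorem eLpNorm_powerNonlinearity (k : ℕ) (u : SpaceTime → ℂ) :
    eLpNorm (powerNonlinearity k u) 2 = eLpNorm u (4 * k + 2 : ℕ) ^ (2 * k + 1) := by
  refine (ENNReal.pow_right_strictMono (n := 2) (by norm_num)).injective ?_
  rw [eLpNorm_two_sq, ← pow_mul, show (2 * k + 1) * 2 = 4 * k + 2 by ring,
    eLpNorm_natCast_pow _ _ (by omega)]
  refine lintegral_congr fun x => ?_
  rw [enorm_powerNonlinearity, ← pow_mul]
  ring_nf

theorem norm_powerNonlinearity_sub_le (k : ℕ) (u v : SpaceTime → ℂ) (x : SpaceTime) :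
    ‖powerNonlinearity k u x - powerNonlinearity k v x‖ ≤
      (2 * k + 1) * (‖u x - v x‖ * (‖u x‖ + ‖v x‖) ^ (2 * k)) := by
  set a := u x
  set b := v x
  have e : powerNonlinearity k u x - powerNonlinearity k v x =
      ((‖a‖ ^ (2 * k) : ℝ) : ℂ) * (a - b) + ((‖a‖ ^ (2 * k) - ‖b‖ ^ (2 * k) : ℝ) : ℂ) * b := by
    simp only [powerNonlinearity]
    push_cast
    ring
  have ha := norm_nonneg a
  have hb := norm_nonneg b
  have h1 : ‖a‖ ^ (2 * k) ≤ (‖a‖ + ‖b‖) ^ (2 * k) := by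
    gcongr
    linarith
  have h2 : |‖a‖ ^ (2 * k) - ‖b‖ ^ (2 * k)| * ‖b‖ ≤
      2 * k * (‖a - b‖ * (‖a‖ + ‖b‖) ^ (2 * k)) := by
    rcases Nat.eq_zero_or_pos k with rfl | hk
    · simp
    have h3 := abs_pow_sub_pow_le ‖a‖ ‖b‖ (2 * k)
    have h4 : max |‖a‖| |‖b‖| ≤ ‖a‖ + ‖b‖ := by
      rw [abs_norm, abs_norm]
      exact max_le (by linarith) (by linarith)
    calc _ ≤ |‖a‖ - ‖b‖| * (2 * k : ℕ) * max |‖a‖| |‖b‖| ^ (2 * k - 1) * ‖b‖ := by gcongr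
      _ ≤ ‖a - b‖ * (2 * k : ℕ) * (‖a‖ + ‖b‖) ^ (2 * k - 1) * (‖a‖ + ‖b‖) := by
          gcongr
          · exact abs_norm_sub_norm_le a b
          · linarith
      _ = ‖a - b‖ * (2 * k : ℕ) * (‖a‖ + ‖b‖) ^ (2 * k) := by
          rw [mul_assoc, ← pow_succ, Nat.sub_add_cancel (by omega)]
      _ = _ := by push_cast; ring
  rw [e]
  refine (norm_add_le _ _).trans ?_
  rw [norm_mul, norm_mul, Complex.norm_real, Complex.norm_real, Real.norm_eq_abs, Real.norm_eq_abs,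
    abs_of_nonneg (by positivity)]
  have h5 := mul_le_mul_of_nonneg_right h1 (norm_nonneg (a - b))
  linarith

/-- Hölder for the `(4k+2)`-th powers with weights `1/(2k+1)` and `2k/(2k+1)`, applied to the
squared norm. -/
theorem eLpNorm_mul_pow_two_mul_le {f g : SpaceTime → ℝ} (hf : AEStronglyMeasurable f)
    (hg : AEStronglyMeasurable g) (k : ℕ) :
    eLpNorm (fun x => f x * g x ^ (2 * k)) 2 ≤
      eLpNorm f (4 * k + 2 : ℕ) * eLpNorm g (4 * k + 2 : ℕ) ^ (2 * k) := by
  have hk : (0 : ℝ) < 2 * k + 1 := by positivity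
  have hroot : ∀ (x : ℝ≥0∞) (j : ℕ), (x ^ (4 * k + 2)) ^ ((j : ℝ) / (2 * k + 1)) = x ^ (2 * j) := by
    intro x j
    rw [← ENNReal.rpow_natCast, ← ENNReal.rpow_mul, ← ENNReal.rpow_natCast]
    congr 1
    push_cast
    field_simp
    ring
  refine (ENNReal.pow_le_pow_left_iff (n := 2) (by norm_num)).1 ?_
  have h := ENNReal.lintegral_mul_norm_pow_le (μ := volume)
    (f := fun x => ‖f x‖ₑ ^ (4 * k + 2)) (g := fun x => ‖g x‖ₑ ^ (4 * k + 2))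
    (hf.enorm.pow_const _) (hg.enorm.pow_const _)
    (p := ((1 : ℕ) : ℝ) / (2 * k + 1)) (q := ((2 * k : ℕ) : ℝ) / (2 * k + 1))
    (by positivity) (by positivity) (by push_cast; field_simp; ring)
  rw [← eLpNorm_natCast_pow _ _ (by omega), ← eLpNorm_natCast_pow _ _ (by omega), hroot, hroot] at h
  simp only [hroot] at h
  rw [eLpNorm_two_sq]
  refine le_trans (le_of_eq (lintegral_congr fun x => ?_)) (h.trans (le_of_eq ?_))
  · rw [enorm_mul, enorm_pow]
    ring
  · ring

theorem eLpNorm_powerNonlinearity_sub_le (k : ℕ) {u v : SpaceTime → ℂ}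
    (hu : AEStronglyMeasurable u) (hv : AEStronglyMeasurable v) :
    eLpNorm (fun x => powerNonlinearity k u x - powerNonlinearity k v x) 2 ≤
      (2 * k + 1 : ℕ) * (eLpNorm (fun x => u x - v x) (4 * k + 2 : ℕ) *
        (eLpNorm u (4 * k + 2 : ℕ) + eLpNorm v (4 * k + 2 : ℕ)) ^ (2 * k)) := by
  have h1 : eLpNorm (fun x => powerNonlinearity k u x - powerNonlinearity k v x) 2 ≤
      eLpNorm (((2 * k + 1 : ℕ) : ℝ) • fun x => ‖u x - v x‖ * (‖u x‖ + ‖v x‖) ^ (2 * k)) 2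
        volume := by
    refine eLpNorm_mono_real fun x => ?_
    simpa using norm_powerNonlinearity_sub_le k u v x
  refine h1.trans ?_
  rw [eLpNorm_const_smul]
  refine mul_le_mul' (le_of_eq ?_) ?_
  · rw [Real.enorm_of_nonneg (by positivity), ENNReal.ofReal_natCast]
  refine (eLpNorm_mul_pow_two_mul_le (hu.sub hv).norm (hu.norm.add hv.norm) k).trans ?_
  rw [← eLpNorm_norm (fun x => u x - v x), ← eLpNorm_norm u, ← eLpNorm_norm v]
  refine mul_le_mul' le_rfl (pow_le_pow_left' ?_ _)
  exact eLpNorm_add_le hu.norm hv.norm (by exact_mod_cast (by omega : 1 ≤ 4 * k + 2))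

/-- The `L²` norm of `|v|^{2k} v` is the `(2k+1)`-th power of the `L^{4k+2}` norm of `v`. Hence the
nonlinear bound, with the weight dropped on the left, is a linear embedding that also applies to
differences. -/
theorem eLpNorm_fourierInv_four_mul_add_two_le {k : ℕ} {s b : ℝ} (hs : 0 ≤ s) {C : ℝ≥0}
    (hC : ∀ g : SpaceTime → ℂ, IntegrableBounded g →
      (∃ R : ℝ, ∀ q : SpaceTime, R < ‖q‖ → g q = 0) →
      freqNorm s 0 (convNonlinearity g k) ≤ C * freqNorm s b g ^ (2 * k + 1))
    {g : SpaceTime → ℂ} (hg : IntegrableBounded g)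
    (hR : ∃ R : ℝ, ∀ q : SpaceTime, R < ‖q‖ → g q = 0) :
    eLpNorm (𝓕⁻ g) (4 * k + 2 : ℕ) ≤ (C + 1 : ℝ≥0) * freqNorm s b g := by
  have hD := hg.convNonlinearity k
  refine (ENNReal.pow_le_pow_left_iff (n := 2 * k + 1) (by omega)).1 ?_
  rw [← eLpNorm_powerNonlinearity,
    ← funext (fourierInv_convNonlinearity hg k), eLpNorm_fourierInv hD.integrable hD.memLp_two]
  refine (eLpNorm_two_le_freqNorm hs le_rfl _).trans ((hC g hg hR).trans ?_)
  rw [mul_pow]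
  gcongr
  -- `C ≤ (C + 1)^(2k+1)` avoids taking a root of `C`.
  exact_mod_cast (le_self_add : C ≤ C + 1).trans (le_self_pow₀ le_add_self (by omega))

/-! ### Truncation and passage to the limit -/

/-- Truncation in height and in space. -/
noncomputable def truncate (n : ℕ) (g : SpaceTime → ℂ) : SpaceTime → ℂ :=
  {q | ‖q‖ ≤ n ∧ ‖g q‖ ≤ n}.indicator g

section

variable {g : SpaceTime → ℂ}

theorem norm_truncate_le (n : ℕ) (g : SpaceTime → ℂ) (q : SpaceTime) :
    ‖truncate n g q‖ ≤ ‖g q‖ := norm_indicator_le_norm_self _ _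

theorem truncate_eq_zero {n : ℕ} {q : SpaceTime} (h : (n : ℝ) < ‖q‖) : truncate n g q = 0 :=
  Set.indicator_of_notMem (fun hq => absurd hq.1 (not_le.2 h)) _

theorem eventually_truncate_eq (g : SpaceTime → ℂ) (q : SpaceTime) :
    ∀ᶠ n : ℕ in atTop, truncate n g q = g q := by
  filter_upwards [eventually_ge_atTop ⌈max ‖q‖ ‖g q‖⌉₊] with n hn
  have h : max ‖q‖ ‖g q‖ ≤ n := Nat.ceil_le.1 hn
  exact Set.indicator_of_mem (show q ∈ {q : SpaceTime | ‖q‖ ≤ n ∧ ‖g q‖ ≤ n} from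
    ⟨(le_max_left _ _).trans h, (le_max_right _ _).trans h⟩) _

theorem integrableBounded_truncate (hg : StronglyMeasurable g) (n : ℕ) :
    IntegrableBounded (truncate n g) := by
  have hS : MeasurableSet {q : SpaceTime | ‖q‖ ≤ n ∧ ‖g q‖ ≤ n} :=
    (measurableSet_le measurable_norm measurable_const).inter
      (measurableSet_le hg.measurable.norm measurable_const)
  have hb : ∀ q, ‖truncate n g q‖ ≤ n := by
    intro q
    by_cases h : q ∈ {q : SpaceTime | ‖q‖ ≤ n ∧ ‖g q‖ ≤ n}
    · rw [truncate, Set.indicator_of_mem h]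
      exact h.2
    · rw [truncate, Set.indicator_of_notMem h, norm_zero]
      positivity
  refine ⟨?_, n, hb⟩
  have hfin : volume (Metric.closedBall (0 : SpaceTime) n) < ∞ := measure_closedBall_lt_top
  have hi : IntegrableOn (truncate n g) (Metric.closedBall (0 : SpaceTime) n) :=
    IntegrableOn.of_bound hfin (hg.indicator hS).aestronglyMeasurable n (.of_forall hb)
  refine (integrableOn_iff_integrable_of_support_subset fun q hq => ?_).1 hi
  by_contra h
  exact hq (truncate_eq_zero (by simpa using h))

theorem norm_truncate_sub_truncate_le {m n : ℕ} (hmn : n ≤ m) (q : SpaceTime) :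
    ‖truncate m g q - truncate n g q‖ ≤ ‖truncate n g q - g q‖ := by
  have hmn' : (n : ℝ) ≤ m := by exact_mod_cast hmn
  by_cases h : ‖q‖ ≤ n ∧ ‖g q‖ ≤ n
  · have h' : ‖q‖ ≤ m ∧ ‖g q‖ ≤ m := ⟨h.1.trans hmn', h.2.trans hmn'⟩
    simp [truncate, Set.indicator, h, h']
  · by_cases h' : ‖q‖ ≤ m ∧ ‖g q‖ ≤ m <;> simp [truncate, Set.indicator, h, h']

theorem tendsto_freqNorm_truncate_sub {s b : ℝ} (hg : StronglyMeasurable g)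
    (hfin : freqNorm s b g < ∞) :
    Tendsto (fun n => freqNorm s b (fun q => truncate n g q - g q)) atTop (𝓝 0) := by
  have hm : ∀ n, Measurable fun q => ‖freqWeight s b q • (truncate n g q - g q)‖ₑ ^ 2 := by
    intro n
    have h1 : Measurable (truncate n g) := hg.measurable.indicator
      ((measurableSet_le measurable_norm measurable_const).inter
        (measurableSet_le hg.measurable.norm measurable_const))
    exact (((continuous_freqWeight s b).measurable.smul (h1.sub hg.measurable)).enorm).pow_const 2
  have h := tendsto_lintegral_of_dominated_convergence (μ := volume)
    (F := fun n q => ‖freqWeight s b q • (truncate n g q - g q)‖ₑ ^ 2) (f := fun _ => 0)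
    (fun q => ‖freqWeight s b q • g q‖ₑ ^ 2) hm
    (fun n => .of_forall fun q => by
      refine pow_le_pow_left' ?_ 2
      rw [enorm_smul, enorm_smul]
      refine mul_le_mul' le_rfl (enorm_le_iff_norm_le.2 ?_)
      by_cases h : ‖q‖ ≤ n ∧ ‖g q‖ ≤ n <;> simp [truncate, Set.indicator, h])
    (by rw [← eLpNorm_two_sq]; exact (ENNReal.pow_lt_top hfin).ne)
    (.of_forall fun q => by
      refine tendsto_const_nhds.congr' ?_
      filter_upwards [eventually_truncate_eq g q] with n hn
      simp [hn])
  simp only [← eLpNorm_two_sq, lintegral_zero] at h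
  have h2 := (ENNReal.continuous_rpow_const (y := (1 / 2 : ℝ))).tendsto 0 |>.comp h
  rw [ENNReal.zero_rpow_of_pos (by norm_num)] at h2
  refine h2.congr fun n => ?_
  simp only [Function.comp_apply]
  rw [← ENNReal.rpow_two, ← ENNReal.rpow_mul, freqNorm]
  norm_num

end

theorem exists_subseq_tendsto_ae {f : ℕ → L2ST} {u : L2ST} (h : Tendsto f atTop (𝓝 u)) :
    ∃ φ : ℕ → ℕ, StrictMono φ ∧ ∀ᵐ x, Tendsto (fun n => f (φ n) x) atTop (𝓝 (u x)) :=
  (tendstoInMeasure_of_tendsto_Lp h).exists_seq_tendsto_ae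

theorem fourier_toLp_fourierInv {g v : SpaceTime → ℂ} (hg : Integrable g) (hg2 : MemLp g 2)
    (hv : MemLp v 2) (h : v = 𝓕⁻ g) : 𝓕 (hv.toLp v : L2ST) = hg2.toLp g := by
  have e : (hv.toLp v : L2ST) = 𝓕⁻ (hg2.toLp g : L2ST) := by
    refine Lp.ext (hv.coeFn_toLp.trans ?_)
    rw [h]
    exact (coeFn_fourierInv_toLp hg hg2).symm
  rw [e, FourierTransform.fourier_fourierInv_eq]

/-- Truncations of `𝓕 u` converge in the weighted norm. The `L^{4k+2}` embedding makes their inverse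
transforms, and then the nonlinearities in `L²`, converge; Fatou's lemma on the Fourier side passes
the weighted bound to the limit. -/
theorem freqNorm_fourier_powerNonlinearity_le {k : ℕ} (hk : 1 ≤ k) {s b : ℝ} (hs : 0 ≤ s)
    (hks : k = 1 ∨ (1 / 2 - 1 / (2 * k) : ℝ) < s) (hb : 1 / 2 < b) :
    ∃ C : ℝ≥0, ∀ u : L2ST, freqNorm s b ((𝓕 u : L2ST) : SpaceTime → ℂ) < ∞ →
      ∃ h : MemLp (powerNonlinearity k u) 2 (volume : Measure SpaceTime),
        freqNorm s 0 ((𝓕 (h.toLp (powerNonlinearity k u)) : L2ST) : SpaceTime → ℂ) ≤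
          C * freqNorm s b ((𝓕 u : L2ST) : SpaceTime → ℂ) ^ (2 * k + 1) := by
  obtain ⟨C, hC⟩ := freqNorm_convNonlinearity_le hk hs hks hb
  refine ⟨C, fun u hu => ?_⟩
  set g : SpaceTime → ℂ := ((𝓕 u : L2ST) : SpaceTime → ℂ) with hgdef
  have hgm : StronglyMeasurable g := Lp.stronglyMeasurable _
  set gn : ℕ → SpaceTime → ℂ := fun n => truncate n g
  have hgn : ∀ n, IntegrableBounded (gn n) := integrableBounded_truncate hgm
  have hsupp : ∀ n, ∃ R : ℝ, ∀ q : SpaceTime, R < ‖q‖ → gn n q = 0 :=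
    fun n => ⟨n, fun q hq => truncate_eq_zero hq⟩
  have hlim := tendsto_freqNorm_truncate_sub hgm hu
  set v : ℕ → SpaceTime → ℂ := fun n => 𝓕⁻ (gn n)
  have hvm : ∀ n, AEStronglyMeasurable (v n) volume :=
    fun n => (continuous_fourierInv (hgn n).integrable).aestronglyMeasurable
  have hL2 : Tendsto (fun n => (𝓕⁻ ((hgn n).memLp_two.toLp (gn n)) : L2ST)) atTop (𝓝 u) := by
    have h1 : Tendsto (fun n => ((hgn n).memLp_two.toLp (gn n) : L2ST)) atTop (𝓝 (𝓕 u)) := by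
      rw [Lp.tendsto_Lp_iff_tendsto_eLpNorm']
      refine tendsto_of_tendsto_of_tendsto_of_le_of_le tendsto_const_nhds hlim
        (fun n => zero_le) fun n => ?_
      refine le_trans (le_of_eq (eLpNorm_congr_ae ?_))
        (eLpNorm_two_le_freqNorm hs (by linarith : 0 ≤ b) _)
      filter_upwards [(hgn n).memLp_two.coeFn_toLp] with q hq
      rw [Pi.sub_apply, hq]
    have h2 := (FourierTransform.continuous_fourierInv.tendsto (𝓕 u : L2ST)).comp h1
    rw [FourierTransform.fourierInv_fourier_eq] at h2
    exact h2
  obtain ⟨φ, hφ, hae⟩ := exists_subseq_tendsto_ae hL2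
  have hvae : ∀ᵐ x, Tendsto (fun j => v (φ j) x) atTop (𝓝 (u x)) := by
    have h1 := ae_all_iff.2 fun n =>
      coeFn_fourierInv_toLp (hgn n).integrable (hgn n).memLp_two
    filter_upwards [hae, h1] with x hx hx1
    exact hx.congr fun j => hx1 (φ j)
  have hstr : ∀ n, eLpNorm (v n) (4 * k + 2 : ℕ) ≤ (C + 1 : ℝ≥0) * freqNorm s b g := fun n =>
    (eLpNorm_fourierInv_four_mul_add_two_le hs hC (hgn n) (hsupp n)).trans
      (mul_le_mul' le_rfl (freqNorm_mono (norm_truncate_le n g)))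
  have hustr : eLpNorm u (4 * k + 2 : ℕ) ≤ (C + 1 : ℝ≥0) * freqNorm s b g :=
    Lp.eLpNorm_le_of_ae_tendsto (.of_forall fun j => hstr (φ j)) (fun j => hvm (φ j)) hvae
  have hufin : eLpNorm u (4 * k + 2 : ℕ) < ∞ :=
    hustr.trans_lt (ENNReal.mul_lt_top ENNReal.coe_lt_top hu)
  -- Fatou along `j` for `v (φ j) - v n`: the embedding applies to this difference of truncations,
  -- which is dominated by `|gn n - g|` for every `j ≥ n`.
  have hdiff : ∀ n, eLpNorm (fun x => u x - v n x) (4 * k + 2 : ℕ) ≤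
      (C + 1 : ℝ≥0) * freqNorm s b (fun q => gn n q - g q) := by
    intro n
    refine Lp.eLpNorm_le_of_ae_tendsto (u := atTop) (f := fun j x => v (φ j) x - v n x) ?_
      (fun j => (hvm _).sub (hvm n)) ?_
    · filter_upwards [eventually_ge_atTop n] with j hj
      have hnj : n ≤ φ j := hj.trans (hφ.id_le j)
      have e : (fun x => v (φ j) x - v n x) = 𝓕⁻ (fun q => gn (φ j) q - gn n q) := by
        have h := fourierInv_add_of_integrable ((hgn (φ j)).sub (hgn n)).integrable
          (hgn n).integrable
        simp only [sub_add_cancel] at h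
        ext x
        have := congrFun h x
        rw [Pi.add_apply] at this
        exact sub_eq_of_eq_add this
      rw [e]
      refine (eLpNorm_fourierInv_four_mul_add_two_le hs hC ((hgn (φ j)).sub (hgn n))
        ⟨φ j, fun q hq => ?_⟩).trans ?_
      · have hq' : (n : ℝ) < ‖q‖ := lt_of_le_of_lt (by exact_mod_cast hnj) hq
        simp only [gn]
        rw [truncate_eq_zero hq, truncate_eq_zero hq', sub_zero]
      · exact mul_le_mul' le_rfl (freqNorm_mono (norm_truncate_sub_truncate_le hnj))
    · filter_upwards [hvae] with x hx
      exact hx.sub_const _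
  have hum : AEStronglyMeasurable (u : SpaceTime → ℂ) volume := Lp.aestronglyMeasurable u
  have hmeas : ∀ w : SpaceTime → ℂ, AEStronglyMeasurable w volume →
      AEStronglyMeasurable (powerNonlinearity k w) volume := fun w hw =>
    (Complex.continuous_ofReal.comp_aestronglyMeasurable (hw.norm.pow (2 * k))).mul hw
  have hPu : MemLp (powerNonlinearity k u) 2 (volume : Measure SpaceTime) :=
    ⟨hmeas _ hum, by rw [eLpNorm_powerNonlinearity]; exact ENNReal.pow_lt_top hufin⟩
  have hPv : ∀ n, MemLp (powerNonlinearity k (v n)) 2 (volume : Measure SpaceTime) := fun n =>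
    ⟨hmeas _ (hvm n), by
      rw [eLpNorm_powerNonlinearity]
      exact ENNReal.pow_lt_top ((hstr n).trans_lt (ENNReal.mul_lt_top ENNReal.coe_lt_top hu))⟩
  refine ⟨hPu, ?_⟩
  set D : ℕ → SpaceTime → ℂ := fun n => convNonlinearity (gn n) k
  have hD : ∀ n, IntegrableBounded (D n) := fun n => (hgn n).convNonlinearity k
  have hFD : ∀ n, 𝓕 ((hPv n).toLp _ : L2ST) = (hD n).memLp_two.toLp (D n) := fun n =>
    fourier_toLp_fourierInv (hD n).integrable _ (hPv n)
      (funext fun x => (fourierInv_convNonlinearity (hgn n) k x).symm)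
  have hPlim : Tendsto (fun n => ((hPv n).toLp _ : L2ST)) atTop (𝓝 (hPu.toLp _)) := by
    rw [Lp.tendsto_Lp_iff_tendsto_eLpNorm']
    set A : ℝ≥0∞ := (C + 1 : ℝ≥0) * freqNorm s b g
    have hA : A ≠ ∞ := (ENNReal.mul_lt_top ENNReal.coe_lt_top hu).ne
    have hbd : ∀ n, eLpNorm (((hPv n).toLp _ : L2ST) - (hPu.toLp _ : L2ST) : SpaceTime → ℂ) 2 ≤
        (2 * k + 1 : ℕ) * (((C + 1 : ℝ≥0) * freqNorm s b (fun q => gn n q - g q)) *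
          (A + A) ^ (2 * k)) := by
      intro n
      have e : eLpNorm (((hPv n).toLp _ : L2ST) - (hPu.toLp _ : L2ST) : SpaceTime → ℂ) 2 volume =
          eLpNorm (fun x => powerNonlinearity k u x - powerNonlinearity k (v n) x) 2 volume := by
        refine eLpNorm_congr_norm_ae ?_
        filter_upwards [(hPv n).coeFn_toLp, hPu.coeFn_toLp] with x h1 h2
        rw [Pi.sub_apply, h1, h2, norm_sub_rev]
      rw [e]
      refine (eLpNorm_powerNonlinearity_sub_le k hum (hvm n)).trans ?_
      gcongr
      · exact hdiff n
      · exact hstr n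
    refine tendsto_of_tendsto_of_tendsto_of_le_of_le tendsto_const_nhds ?_
      (fun n => zero_le) hbd
    have hz : (0 : ℝ≥0∞) = (2 * k + 1 : ℕ) * (((C + 1 : ℝ≥0) * 0) * (A + A) ^ (2 * k)) := by simp
    rw [hz]
    refine ENNReal.Tendsto.const_mul (ENNReal.Tendsto.mul_const (ENNReal.Tendsto.const_mul hlim
      (Or.inr ENNReal.coe_ne_top)) (Or.inr ?_)) (Or.inr (ENNReal.natCast_ne_top _))
    exact ENNReal.pow_ne_top (ENNReal.add_ne_top.2 ⟨hA, hA⟩)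
  have hFlim : Tendsto (fun n => ((hD n).memLp_two.toLp (D n) : L2ST)) atTop
      (𝓝 (𝓕 (hPu.toLp _ : L2ST))) :=
    (((Lp.fourierTransformₗᵢ SpaceTime ℂ).continuous.tendsto _).comp hPlim).congr hFD
  -- `L²` convergence of the transforms gives a.e. convergence along a subsequence, which is all
  -- Fatou needs for the weighted norm.
  obtain ⟨χ, -, hχ⟩ := exists_subseq_tendsto_ae hFlim
  refine Lp.eLpNorm_le_of_ae_tendsto (u := atTop)
    (f := fun j q => freqWeight s 0 q • D (χ j) q) (.of_forall fun j => ?_)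
    (fun j => (continuous_freqWeight s 0).aestronglyMeasurable.smul (hD _).integrable.1) ?_
  · refine (hC _ (hgn (χ j)) (hsupp _)).trans ?_
    gcongr
    exact freqNorm_mono (norm_truncate_le _ g)
  · have h1 := ae_all_iff.2 fun n => (hD n).memLp_two.coeFn_toLp
    filter_upwards [hχ, h1] with q hq hq1
    exact (hq.congr fun j => hq1 (χ j)).const_smul _

/-! ### The exponent condition and the conclusion -/

/-- After clearing denominators, `1/2 - 1/(2k) ≤ (4k-5)/(4(2k-1))` amounts to `k ≥ 2`. -/
theorem sobolev_exponent_lt {k : ℕ} (hk : 1 ≤ k) {s : ℝ}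
    (hs : (4 * (k : ℝ) - 5) / (4 * (2 * (k : ℝ) - 1)) < s) :
    k = 1 ∨ (1 / 2 - 1 / (2 * k) : ℝ) < s := by
  rcases hk.eq_or_lt with h | h
  · exact Or.inl h.symm
  · refine Or.inr (lt_of_le_of_lt ?_ hs)
    have hk2 : (2 : ℝ) ≤ k := by exact_mod_cast h
    have h1 : (0 : ℝ) < 4 * (2 * k - 1) := by linarith
    rw [show (1 / 2 - 1 / (2 * k) : ℝ) = (k - 1) / (2 * k) by field_simp,
      div_le_div_iff₀ (by positivity) h1]
    nlinarith

theorem lemma5p1 (k : ℕ) (hk : 1 ≤ k) (s b : ℝ) (hs_nonneg : 0 ≤ s)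
    (hs : (4 * (k : ℝ) - 5) / (4 * (2 * (k : ℝ) - 1)) < s) (hb : 1 / 2 < b) :
    ∃ C : ℝ≥0, ∀ u : L2ST, MemX s b u →
      ∃ h : MemLp (powerNonlinearity k u) 2 (volume : Measure SpaceTime),
        MemX s 0 (h.toLp (powerNonlinearity k u)) ∧
        xNorm s 0 (h.toLp (powerNonlinearity k u)) ≤ C * xNorm s b u ^ (2 * k + 1) := by
  obtain ⟨C, hC⟩ := freqNorm_fourier_powerNonlinearity_le hk hs_nonneg
    (sobolev_exponent_lt hk hs) hb
  refine ⟨C, fun u hu => ?_⟩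
  set c := ENNReal.ofReal (2 * Real.pi)
  -- The rescaling factor `c = 2π` occurs once on the left and `2k + 1` times on the right, so `c ≥
  -- 1` lets `C` stay unchanged.
  have hc1 : 1 ≤ c := by
    rw [← ENNReal.ofReal_one]
    exact ENNReal.ofReal_le_ofReal (by linarith [Real.pi_gt_three])
  set F := freqNorm s b ((𝓕 u : L2ST) : SpaceTime → ℂ)
  have hF : F < ∞ := by
    refine lt_of_le_of_lt ?_ hu
    rw [xNorm_eq]
    exact le_mul_of_one_le_left' hc1
  obtain ⟨h, hle⟩ := hC u hF
  have key : xNorm s 0 (h.toLp (powerNonlinearity k u)) ≤ C * xNorm s b u ^ (2 * k + 1) := by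
    rw [xNorm_eq, xNorm_eq]
    calc _ ≤ c * (C * F ^ (2 * k + 1)) := by gcongr
      _ = C * (c * F ^ (2 * k + 1)) := by ring
      _ ≤ C * (c ^ (2 * k + 1) * F ^ (2 * k + 1)) := by
          gcongr
          exact le_self_pow₀ hc1 (by omega)
      _ = _ := by rw [mul_pow]
  exact ⟨h, key.trans_lt (ENNReal.mul_lt_top ENNReal.coe_lt_top (ENNReal.pow_lt_top hu)), key⟩
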